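/- An ordered graph is a finite simple graph whose vertex set is linearly ordered. An ordered graph $H$ contains an ordered graph $G$ if some subgraph of $H$ is order isomorphic to $G$ (i.e. there is a strictly increasing map from the vertices of $G$ to those of $H$ that sends edges to edges); otherwise $H$ avoids $G$. Containment of $G'$ in $G$ is strict if the subgraph of $G$ isomorphic to $G'$ is not all of $G$. Let $\mathrm{ex}_<(n,G)$ be the maximum number of edges of an ordered graph on $n$ vertices that avoids $G$ (and $0$ if no ordered graph on $n$ vertices avoids $G$). Call $G$ minimally non-linear if $\mathrm{ex}_<(n,G)=\omega(n)$ but $\mathrm{ex}_<(n,G')=O(n)$ for every ordered graph $G'$ strictly contained in $G$. Let $G$ be a minimally non-linear ordered graph whose underlying graph is bipartite. (1) If $G$ has $k$ vertices in total and its underlying graph is not isomorphic to $K_{2,2}$, then $G$ has at most $k-1$ edges. (2) If the vertex set of $G$ is partitioned in any way into two independent sets, one of which has $k$ vertices, then $G$ has at most $5k-3$ edges. -/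

import Mathlib

open Filter Asymptotics

/-- An ordered graph is a simple graph on a linearly ordered vertex set. The ordered graph `H`
contains the ordered graph `G` if some subgraph of `H` is order isomorphic to `G`: there is a
strictly increasing map of vertices that carries every edge of `G` to an edge of `H`. -/
def OrdContains {W V : Type*} [LinearOrder W] [LinearOrder V]
    (H : SimpleGraph W) (G : SimpleGraph V) : Prop :=
  ∃ f : V ↪o W, ∀ a b : V, G.Adj a b → H.Adj (f a) (f b)

open Classical in
/-- The ordered extremal function: the maximum number of edges of an ordered graph on `n` vertices
that avoids `G` (it is `0` if no ordered graph on `n` vertices avoids `G`, which can only happen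
if `G` has no edges). -/
noncomputable def exOrd {V : Type*} [LinearOrder V] (n : ℕ) (G : SimpleGraph V) : ℕ :=
  (Finset.univ.filter fun H : SimpleGraph (Fin n) => ¬ OrdContains H G).sup
    fun H => H.edgeSet.ncard

/-- `G'` is strictly contained in `G`: some subgraph of `G` is order isomorphic to `G'`, and that
subgraph is not the whole of `G` (for finite graphs: `G` is not contained in `G'`). -/
def OrdStrictlyContains {V U : Type*} [LinearOrder V] [LinearOrder U]
    (G : SimpleGraph V) (G' : SimpleGraph U) : Prop :=
  OrdContains G G' ∧ ¬ OrdContains G' G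

/-- A finite ordered graph `G` is minimally non-linear if its extremal function is `ω(n)`, while
that of every ordered graph strictly contained in `G` is `O(n)`. Every finite ordered graph is
order isomorphic to one on some `Fin m`. -/
def MinNonlinear {V : Type*} [LinearOrder V] (G : SimpleGraph V) : Prop :=
  ((fun n : ℕ => (n : ℝ)) =o[atTop] fun n : ℕ => (exOrd n G : ℝ)) ∧
    ∀ (m : ℕ) (G' : SimpleGraph (Fin m)), OrdStrictlyContains G G' →
      (fun n : ℕ => (exOrd n G' : ℝ)) =O[atTop] fun n : ℕ => (n : ℝ)

/-! ### Containment, and reversal of the vertex order -/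

section Containment

/-! Minimality enters mainly through `MinNonlinear.host`: deleting an edge makes the extremal
function linear, so every superlinear family of hosts contains each proper subset of the edges of
`G`. A dense family avoiding a small pattern therefore excludes it from `G`. Complete bipartite
hosts put all left endpoints before all right endpoints (`MinNonlinear.interval`), so `G` is a 0-1
matrix with left endpoints as rows and right endpoints as columns. Hosts with edges from `i` to `i +
2 ^ k`, with rows or columns possibly reversed, exclude four configurations via `pow_core`; the
Davenport–Schinzel type matrices of `exists_dense_alternation_free` exclude two rows alternating as
a b a b. `MinNonlinear.no_insertion` works instead by thinning out a host.

For (1), a non-first entry of a row has nothing below it in its column. Charging first entries to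
their rows and all others to their columns is thus injective, and the first nonempty column is never
charged.

For (2), every edge has exactly one end in the chosen part A. Let p and q count the nonempty rows
and columns in A. An entry of a row in A is first, or is reached from its predecessor by a tight
step (no nonempty column between), a gap (only columns of A between), or a wide gap. There are at
most p first entries, q gaps and p - 1 wide gaps, and each tight step is charged to a used entry of
one of these kinds. Columns in A are treated by transposing and reversing. This alone gives 6(p + q)
- 4. The gain comes from used entries after gaps: those of the weak and mid kinds are matched with
unused first entries (mid ones in the dual), and on each side all strong ones but one with unused
entries after wide gaps. That leaves 5(p + q) - 2, and `exists_freeLoose` recovers one more when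
both sides have an exceptional strong gap. -/

lemma OrdContains.trans {U V W : Type*} [LinearOrder U] [LinearOrder V] [LinearOrder W]
    {H : SimpleGraph W} {G : SimpleGraph V} {K : SimpleGraph U}
    (h₁ : OrdContains H G) (h₂ : OrdContains G K) : OrdContains H K := by
  obtain ⟨f, hf⟩ := h₁
  obtain ⟨g, hg⟩ := h₂
  exact ⟨g.trans f, fun a b hab => hf _ _ (hg _ _ hab)⟩

lemma OrdContains.ncard_le {V W : Type*} [LinearOrder V] [LinearOrder W] [Finite W]
    {H : SimpleGraph W} {G : SimpleGraph V} (h : OrdContains H G) :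
    G.edgeSet.ncard ≤ H.edgeSet.ncard := by
  obtain ⟨f, hf⟩ := h
  refine Set.ncard_le_ncard_of_injOn (Sym2.map f) ?_ (Sym2.map.injective f.injective).injOn
    (Set.toFinite _)
  intro e
  induction e with
  | _ a b => exact fun hab => hf a b hab

lemma exOrd_le {V : Type*} [LinearOrder V] {n m : ℕ} {G : SimpleGraph V}
    (h : ∀ H : SimpleGraph (Fin n), ¬ OrdContains H G → H.edgeSet.ncard ≤ m) :
    exOrd n G ≤ m := by
  classical
  unfold exOrd
  refine Finset.sup_le fun H hH => h H ?_
  simpa using hH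

lemma le_exOrd {V : Type*} [LinearOrder V] {n : ℕ} {G : SimpleGraph V}
    {H : SimpleGraph (Fin n)} (h : ¬ OrdContains H G) : H.edgeSet.ncard ≤ exOrd n G := by
  classical
  unfold exOrd
  exact Finset.le_sup (f := fun H : SimpleGraph (Fin n) => H.edgeSet.ncard)
    (by simpa using h)

/-- An order-reversing isomorphism of ordered graphs. -/
structure AntiIso {V U : Type*} [LinearOrder V] [LinearOrder U]
    (G : SimpleGraph V) (K : SimpleGraph U) where
  toEquiv : V ≃ U
  le_iff : ∀ a b, toEquiv b ≤ toEquiv a ↔ a ≤ b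
  adj_iff : ∀ a b, K.Adj (toEquiv a) (toEquiv b) ↔ G.Adj a b

def AntiIso.symm {V U : Type*} [LinearOrder V] [LinearOrder U]
    {G : SimpleGraph V} {K : SimpleGraph U} (φ : AntiIso G K) : AntiIso K G where
  toEquiv := φ.toEquiv.symm
  le_iff a b := by rw [← φ.le_iff]; simp
  adj_iff a b := by rw [← φ.adj_iff]; simp

lemma AntiIso.ordContains {V U W X : Type*} [LinearOrder V] [LinearOrder U] [LinearOrder W]
    [LinearOrder X] {G : SimpleGraph V} {K : SimpleGraph U} {H : SimpleGraph W}
    {J : SimpleGraph X} (φ : AntiIso G K) (ψ : AntiIso H J) (h : OrdContains H G) :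
    OrdContains J K := by
  obtain ⟨f, hf⟩ := h
  refine ⟨OrderEmbedding.ofMapLEIff (fun u => ψ.toEquiv (f (φ.symm.toEquiv u))) ?_, ?_⟩
  · intro a b
    rw [ψ.le_iff, f.le_iff_le, φ.symm.le_iff]
  · intro a b hab
    exact (ψ.adj_iff _ _).2 (hf _ _ ((φ.symm.adj_iff _ _).2 hab))

def AntiIso.rev {n : ℕ} (H : SimpleGraph (Fin n)) : AntiIso H (H.comap Fin.rev) where
  toEquiv := Fin.revPerm
  le_iff a b := by simp
  adj_iff a b := by simp

lemma AntiIso.exOrd_le {V U : Type*} [LinearOrder V] [LinearOrder U]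
    {G : SimpleGraph V} {K : SimpleGraph U} (φ : AntiIso G K) (n : ℕ) :
    exOrd n G ≤ exOrd n K := by
  refine _root_.exOrd_le fun H hH => ?_
  have h1 : ¬ OrdContains (H.comap Fin.rev) K :=
    fun h => hH (φ.symm.ordContains (AntiIso.rev H).symm h)
  refine le_trans ?_ (le_exOrd h1)
  refine Set.ncard_le_ncard_of_injOn (Sym2.map Fin.rev) ?_
    (Sym2.map.injective Fin.rev_injective).injOn (Set.toFinite _)
  intro e
  induction e with
  | _ a b => intro hab; simpa using hab

lemma AntiIso.exOrd_eq {V U : Type*} [LinearOrder V] [LinearOrder U]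
    {G : SimpleGraph V} {K : SimpleGraph U} (φ : AntiIso G K) (n : ℕ) :
    exOrd n G = exOrd n K :=
  le_antisymm (φ.exOrd_le n) (φ.symm.exOrd_le n)

/-- This transfers every restriction on rows to columns, by reading the matrix from the opposite
corner. -/
lemma MinNonlinear.anti {V U : Type*} [LinearOrder V] [LinearOrder U]
    {G : SimpleGraph V} {K : SimpleGraph U} (hG : MinNonlinear G) (φ : AntiIso G K) :
    MinNonlinear K := by
  refine ⟨?_, fun m G' hG' => ?_⟩
  · simpa only [φ.exOrd_eq] using hG.1
  · have h := hG.2 m (G'.comap Fin.rev)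
      ⟨(AntiIso.rev G').ordContains φ.symm hG'.1,
        fun h => hG'.2 (φ.ordContains (AntiIso.rev G').symm h)⟩
    simpa only [(AntiIso.rev G').exOrd_eq] using h

/-- The same graph on the order dual of the vertex set. -/
def dualGraph {V : Type*} (G : SimpleGraph V) : SimpleGraph Vᵒᵈ where
  Adj a b := G.Adj (OrderDual.ofDual a) (OrderDual.ofDual b)
  symm := ⟨fun _ _ h => h.symm⟩
  loopless := ⟨fun _ h => h.ne rfl⟩

def AntiIso.dual {V : Type*} [LinearOrder V] (G : SimpleGraph V) : AntiIso G (dualGraph G) where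
  toEquiv := OrderDual.toDual
  le_iff _ _ := Iff.rfl
  adj_iff _ _ := Iff.rfl

end Containment

/-! ### Dense hosts and the two-interval structure -/

section Minimal

variable {V : Type*} [Fintype V] [LinearOrder V] {G : SimpleGraph V}

/-- Deleting an edge of a minimally non-linear graph makes the extremal function linear. -/
lemma MinNonlinear.linear_deleteEdge (hG : MinNonlinear G) {e : Sym2 V} (he : e ∈ G.edgeSet) :
    ∃ C N : ℕ, ∀ n ≥ N, ∀ H : SimpleGraph (Fin n),
      ¬ OrdContains H (G.deleteEdges {e}) → H.edgeSet.ncard ≤ C * n := by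
  classical
  let φ : Fin (Fintype.card V) ≃o V := Fintype.orderIsoFinOfCardEq V rfl
  set G₀ := G.deleteEdges {e} with hG₀
  let G' : SimpleGraph (Fin (Fintype.card V)) := G₀.comap φ
  have h1 : OrdContains G₀ G' := ⟨φ.toOrderEmbedding, fun a b hab => hab⟩
  have h2 : OrdContains G' G₀ :=
    ⟨φ.symm.toOrderEmbedding, fun a b hab => by simpa [G'] using hab⟩
  have h3 : OrdContains G G₀ :=
    ⟨(OrderIso.refl V).toOrderEmbedding, fun a b hab => (SimpleGraph.deleteEdges_le _) hab⟩
  have hlt : G₀.edgeSet.ncard < G.edgeSet.ncard := by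
    refine Set.ncard_lt_ncard ?_ (Set.toFinite _)
    rw [hG₀, SimpleGraph.edgeSet_deleteEdges]
    exact ⟨Set.sdiff_subset, fun h => (h he).2 rfl⟩
  have hlin := hG.2 _ G' ⟨h3.trans h1, fun h => by
    have := (h1.trans h).ncard_le
    omega⟩
  obtain ⟨c, hc⟩ := hlin.bound
  obtain ⟨N, hN⟩ := eventually_atTop.1 hc
  refine ⟨⌈c⌉₊, N, fun n hn H hH => ?_⟩
  have h4 : H.edgeSet.ncard ≤ exOrd n G' := le_exOrd fun h => hH (h.trans h2)
  have h5 := hN n hn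
  simp only [Real.norm_natCast] at h5
  have h6 : (exOrd n G' : ℝ) ≤ (⌈c⌉₊ * n : ℕ) := by
    push_cast
    exact h5.trans (mul_le_mul_of_nonneg_right (Nat.le_ceil c) (Nat.cast_nonneg _))
  exact h4.trans (by exact_mod_cast h6)

omit [Fintype V] in
lemma MinNonlinear.not_linear (hG : MinNonlinear G) (C N : ℕ) :
    ∃ n ≥ N, C * n < exOrd n G := by
  by_contra! h
  have h1 := hG.1.def (c := 1 / (C + 1)) (by positivity)
  obtain ⟨M, hM⟩ := eventually_atTop.1 h1
  have h2 := hM (max (max M N) 1) (by simp)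
  have h3 := h (max (max M N) 1) (by simp)
  have h4 : 1 ≤ max (max M N) 1 := by simp
  generalize max (max M N) 1 = n at h2 h3 h4
  simp only [Real.norm_natCast] at h2
  have h5 : (exOrd n G : ℝ) ≤ C * n := by exact_mod_cast h3
  have h6 : (1 : ℝ) ≤ n := by exact_mod_cast h4
  rw [one_div, inv_mul_eq_div, le_div_iff₀ (by positivity)] at h2
  nlinarith

/-- The graph on `Fin n` whose edges are the pairs in `S`. -/
def pairGraph (n : ℕ) (S : Finset (ℕ × ℕ)) : SimpleGraph (Fin n) where
  Adj a b := (a < b ∧ ((a : ℕ), (b : ℕ)) ∈ S) ∨ (b < a ∧ ((b : ℕ), (a : ℕ)) ∈ S)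
  symm := ⟨fun _ _ h => h.symm⟩
  loopless := ⟨fun a h => by simp at h⟩

lemma card_le_ncard_pairGraph {n : ℕ} {S : Finset (ℕ × ℕ)}
    (hS : ∀ p ∈ S, p.1 < p.2 ∧ p.2 < n) : S.card ≤ (pairGraph n S).edgeSet.ncard := by
  rcases Nat.eq_zero_or_pos n with rfl | hn
  · have h0 : S = ∅ := Finset.eq_empty_of_forall_notMem fun p hp => by simpa using (hS p hp).2
    simp [h0]
  have : NeZero n := ⟨hn.ne'⟩
  have hval : ∀ a, a < n → (Fin.ofNat n a : ℕ) = a := fun a ha => by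
    simp [Nat.mod_eq_of_lt ha]
  rw [← Set.ncard_coe_finset S]
  refine Set.ncard_le_ncard_of_injOn
    (fun p => s(Fin.ofNat n p.1, Fin.ofNat n p.2)) ?_ ?_ (Set.toFinite _)
  · rintro ⟨a, b⟩ hp
    obtain ⟨h1, h2⟩ := hS _ hp
    have h3 : a < n := lt_trans h1 h2
    refine Or.inl ⟨?_, ?_⟩
    · rw [Fin.lt_def, hval _ h3, hval _ h2]; exact h1
    · rw [hval _ h3, hval _ h2]; exact hp
  · rintro ⟨a, b⟩ hp ⟨a', b'⟩ hp' heq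
    obtain ⟨h1, h2⟩ := hS _ hp
    obtain ⟨h1', h2'⟩ := hS _ hp'
    simp only at h1 h2 h1' h2' heq
    rw [Sym2.eq_iff] at heq
    simp only [Fin.ext_iff] at heq
    rw [hval a (by omega), hval b (by omega), hval a' (by omega), hval b' (by omega)] at heq
    ext <;> simp <;> omega

/-- Every dense host contains each proper set of edges of a minimally non-linear graph. -/
lemma MinNonlinear.host (hG : MinNonlinear G) {T : Finset (Sym2 V)}
    (hT : T.card < G.edgeSet.ncard) :
    ∃ C N : ℕ, ∀ n ≥ N, ∀ S : Finset (ℕ × ℕ), (∀ p ∈ S, p.1 < p.2 ∧ p.2 < n) →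
      C * n < S.card →
      ∃ f : V → ℕ, StrictMono f ∧ ∀ a b, a < b → G.Adj a b → s(a, b) ∈ T → (f a, f b) ∈ S := by
  rw [← Set.ncard_coe_finset T] at hT
  obtain ⟨e, he, heT⟩ := Set.exists_mem_notMem_of_ncard_lt_ncard hT
  obtain ⟨C, N, h⟩ := hG.linear_deleteEdge he
  refine ⟨C, N, fun n hn S hS hC => ?_⟩
  by_cases hc : OrdContains (pairGraph n S) (G.deleteEdges {e})
  · obtain ⟨f, hf⟩ := hc
    refine ⟨fun v => f v, fun a b hab => f.strictMono hab, fun a b hab hadj hmem => ?_⟩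
    have h1 : (G.deleteEdges {e}).Adj a b := by
      rw [SimpleGraph.deleteEdges_adj]
      refine ⟨hadj, fun h => heT ?_⟩
      rw [Set.mem_singleton_iff] at h
      rw [← h]; exact hmem
    rcases hf a b h1 with h2 | h2
    · exact h2.2
    · exact absurd h2.1 (f.strictMono hab).le.not_gt
  · have := h n hn _ hc
    have := card_le_ncard_pairGraph hS
    omega

/-- An edgeless `G` embeds in every host with enough vertices, so its extremal function would
eventually vanish. -/
lemma MinNonlinear.edgeSet_ncard_pos (hG : MinNonlinear G) : 0 < G.edgeSet.ncard := by
  by_contra h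
  have h0 : G.edgeSet = ∅ := by
    rw [← Set.ncard_eq_zero (Set.toFinite _)]; omega
  have hbot : ∀ a b, ¬ G.Adj a b := fun a b hab => by
    have : s(a, b) ∈ G.edgeSet := hab
    rw [h0] at this; exact this
  obtain ⟨n, hn, hlt⟩ := hG.not_linear 0 (Fintype.card V)
  obtain ⟨H, hH⟩ : ∃ H : SimpleGraph (Fin n), ¬ OrdContains H G := by
    by_contra! hall
    have := exOrd_le (G := G) (m := 0) fun H hH => absurd (hall H) hH
    omega
  refine hH ⟨(Fintype.orderIsoFinOfCardEq V rfl).symm.toOrderEmbedding.trans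
    (Fin.castLEOrderEmb hn), fun a b hab => absurd hab (hbot a b)⟩

/-- Left endpoints of edges precede right endpoints of edges. -/
lemma MinNonlinear.interval (hG : MinNonlinear G) (he : 3 ≤ G.edgeSet.ncard) {a b c d : V}
    (hab : G.Adj a b) (hlt : a < b) (hcd : G.Adj c d) (hlt' : c < d) : a < d := by
  classical
  have hT : ({s(a, b), s(c, d)} : Finset (Sym2 V)).card < G.edgeSet.ncard :=
    lt_of_le_of_lt Finset.card_le_two he
  obtain ⟨C, N, h⟩ := hG.host hT
  -- The host is complete bipartite between the two halves of `2 * m` vertices; its `m ^ 2` edges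
  -- exceed `C * (2 * m)` because `m > 2 * C`.
  set m := N + 2 * C + 1 with hm
  obtain ⟨f, hf, hfS⟩ := h (2 * m) (by omega) (Finset.range m ×ˢ Finset.Ico m (2 * m))
    (fun p hp => by
      simp only [Finset.mem_product, Finset.mem_range, Finset.mem_Ico] at hp
      omega)
    (by
      simp only [Finset.card_product, Finset.card_range, Nat.card_Ico]
      have : 2 * m - m = m := by omega
      rw [this]
      nlinarith)
  have h1 := hfS a b hlt hab (by simp)
  have h2 := hfS c d hlt' hcd (by simp)
  simp only [Finset.mem_product, Finset.mem_range, Finset.mem_Ico] at h1 h2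
  rw [← hf.lt_iff_lt]
  omega

end Minimal

/-! ### Inserting a vertex of degree one -/

section Insertion

open Classical in
/-- The pairs `(a, b)` with `a < b` that are edges. -/
noncomputable def edgePairs {V : Type*} [Fintype V] [LinearOrder V] (G : SimpleGraph V) :
    Finset (V × V) :=
  Finset.univ.filter fun p => p.1 < p.2 ∧ G.Adj p.1 p.2

lemma mem_edgePairs {V : Type*} [Fintype V] [LinearOrder V] {G : SimpleGraph V} {p : V × V} :
    p ∈ edgePairs G ↔ p.1 < p.2 ∧ G.Adj p.1 p.2 := by
  classical
  simp [edgePairs]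

lemma ncard_edgeSet_eq {V : Type*} [Fintype V] [LinearOrder V] (G : SimpleGraph V) :
    G.edgeSet.ncard = (edgePairs G).card := by
  classical
  have h : G.edgeSet = (fun p : V × V => s(p.1, p.2)) '' (edgePairs G : Set (V × V)) := by
    ext e
    induction e with
    | _ a b =>
      simp only [SimpleGraph.mem_edgeSet, Set.mem_image, Finset.mem_coe, mem_edgePairs,
        Prod.exists]
      constructor
      · intro hab
        rcases lt_or_gt_of_ne hab.ne with h | h
        · exact ⟨a, b, ⟨h, hab⟩, rfl⟩
        · exact ⟨b, a, ⟨h, hab.symm⟩, Sym2.eq_swap⟩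
      · rintro ⟨x, y, ⟨_, hxy⟩, h⟩
        have : s(x, y) ∈ G.edgeSet := hxy
        rw [h] at this; exact this
  rw [h, Set.InjOn.ncard_image, Set.ncard_coe_finset]
  rintro ⟨a, b⟩ hp ⟨a', b'⟩ hp' heq
  simp only [Finset.mem_coe, mem_edgePairs] at hp hp'
  simp only [Sym2.eq_iff] at heq
  rcases heq with ⟨rfl, rfl⟩ | ⟨rfl, rfl⟩
  · rfl
  · exact absurd hp.1 hp'.1.not_gt

variable {W : Type*} [Fintype W] [LinearOrder W]

open Classical in
noncomputable def rightNbrs (H : SimpleGraph W) (v : W) : Finset W :=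
  Finset.univ.filter fun z => v < z ∧ H.Adj v z

open Classical in
/-- The number of right neighbours of `v` beyond `z`. -/
noncomputable def beyond (H : SimpleGraph W) (v z : W) : ℕ :=
  ((rightNbrs H v).filter fun z' => z < z').card

lemma mem_rightNbrs {H : SimpleGraph W} {v z : W} : z ∈ rightNbrs H v ↔ v < z ∧ H.Adj v z := by
  classical
  simp [rightNbrs]

/-- Keep, at each vertex, the right neighbours whose number of neighbours beyond is a positive
multiple of `t`. -/
noncomputable def sparsify (H : SimpleGraph W) (t : ℕ) : SimpleGraph W where
  Adj a b := (a < b ∧ H.Adj a b ∧ t ∣ beyond H a b ∧ 0 < beyond H a b) ∨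
    (b < a ∧ H.Adj b a ∧ t ∣ beyond H b a ∧ 0 < beyond H b a)
  symm := ⟨fun _ _ h => h.symm⟩
  loopless := ⟨fun a h => by simp at h⟩

lemma sparsify_adj {H : SimpleGraph W} {t : ℕ} {a b : W} (hab : a < b) :
    (sparsify H t).Adj a b ↔ H.Adj a b ∧ t ∣ beyond H a b ∧ 0 < beyond H a b := by
  simp [sparsify, hab, hab.le.not_gt]

lemma sparsify_le (H : SimpleGraph W) (t : ℕ) : sparsify H t ≤ H := by
  rintro a b (h | h)
  · exact h.2.1
  · exact h.2.1.symm

lemma beyond_lt {H : SimpleGraph W} {v z z' : W} (h : z < z') (hz' : z' ∈ rightNbrs H v) :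
    beyond H v z' < beyond H v z := by
  classical
  refine Finset.card_lt_card ?_
  rw [Finset.ssubset_iff_of_subset]
  · exact ⟨z', by simp [hz', h], by simp⟩
  · intro w hw
    simp only [Finset.mem_filter] at hw ⊢
    exact ⟨hw.1, h.trans hw.2⟩

lemma beyond_injOn (H : SimpleGraph W) (v : W) :
    Set.InjOn (beyond H v) (rightNbrs H v : Set W) := by
  intro a ha b hb hab
  rcases lt_trichotomy a b with h | h | h
  · have := beyond_lt h hb; omega
  · exact h
  · have := beyond_lt h ha; omega

lemma image_beyond (H : SimpleGraph W) (v : W) :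
    (rightNbrs H v).image (beyond H v) = Finset.range (rightNbrs H v).card := by
  classical
  refine Finset.eq_of_subset_of_card_le ?_ ?_
  · intro j hj
    obtain ⟨z, hz, rfl⟩ := Finset.mem_image.1 hj
    rw [Finset.mem_range]
    refine Finset.card_lt_card ?_
    rw [Finset.ssubset_iff_of_subset (Finset.filter_subset _ _)]
    exact ⟨z, hz, by simp⟩
  · rw [Finset.card_image_of_injOn (beyond_injOn H v), Finset.card_range]

/-- The values of `beyond` fill an initial segment. Each block of `t` consecutive values that meets
it does so at a multiple of `t`, which is kept unless it is zero. -/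
lemma card_rightNbrs_le (H : SimpleGraph W) (v : W) {t : ℕ} (ht : 0 < t) :
    (rightNbrs H v).card ≤ t * ((rightNbrs (sparsify H t) v).card + 1) := by
  classical
  set d := (rightNbrs H v).card with hd
  have h1 : (Finset.range d).card ≤ t * ((Finset.range d).image (· / t)).card := by
    refine Finset.card_le_mul_card_image _ _ fun q hq => ?_
    calc ((Finset.range d).filter fun j => j / t = q).card
        ≤ (Finset.Ico (t * q) (t * q + t)).card := Finset.card_le_card fun j hj => by
          simp only [Finset.mem_filter] at hj
          rw [Finset.mem_Ico]
          have := Nat.div_add_mod j t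
          have := Nat.mod_lt j ht
          rw [hj.2] at *
          omega
      _ = t := by simp
  have h2 : (Finset.range d).image (· / t) ⊆
      insert 0 ((rightNbrs (sparsify H t) v).image fun z => beyond H v z / t) := by
    intro q hq
    obtain ⟨j, hj, rfl⟩ := Finset.mem_image.1 hq
    rw [Finset.mem_insert]
    by_cases h0 : j / t = 0
    · exact Or.inl h0
    right
    have h3 : t * (j / t) ∈ (rightNbrs H v).image (beyond H v) := by
      rw [image_beyond, Finset.mem_range]
      exact lt_of_le_of_lt (Nat.mul_div_le j t) (Finset.mem_range.1 hj)
    obtain ⟨z, hz, hzj⟩ := Finset.mem_image.1 h3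
    refine Finset.mem_image.2 ⟨z, ?_, ?_⟩
    · rw [mem_rightNbrs] at hz ⊢
      refine ⟨hz.1, (sparsify_adj hz.1).2 ⟨hz.2, ⟨_, hzj⟩, ?_⟩⟩
      rw [hzj]; exact Nat.mul_pos ht (Nat.pos_of_ne_zero h0)
    · show beyond H v z / t = j / t
      rw [hzj, Nat.mul_div_cancel_left _ ht]
  have h3 := Finset.card_le_card h2
  have h4 := Finset.card_insert_le 0
    ((rightNbrs (sparsify H t) v).image fun z => beyond H v z / t)
  have h5 : ((rightNbrs (sparsify H t) v).image fun z => beyond H v z / t).card ≤ _ :=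
    Finset.card_image_le
  rw [Finset.card_range] at h1
  exact h1.trans (Nat.mul_le_mul_left _ (by omega))

lemma card_edgePairs (H : SimpleGraph W) :
    (edgePairs H).card = ∑ v, (rightNbrs H v).card := by
  classical
  rw [Finset.card_eq_sum_card_fiberwise (f := Prod.fst) (t := Finset.univ) (by simp)]
  refine Finset.sum_congr rfl fun v _ => ?_
  refine Finset.card_bij (fun p _ => p.2) ?_ ?_ ?_
  · rintro ⟨a, b⟩ h
    simp only [Finset.mem_filter, mem_edgePairs] at h
    obtain ⟨h, rfl⟩ := h
    exact mem_rightNbrs.2 h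
  · rintro ⟨a, b⟩ h ⟨a', b'⟩ h' heq
    simp only [Finset.mem_filter] at h h' heq
    ext <;> simp [h.2, h'.2, heq]
  · intro b hb
    exact ⟨(v, b), by simpa [mem_edgePairs] using mem_rightNbrs.1 hb, rfl⟩

lemma ncard_le_sparsify (H : SimpleGraph W) {t : ℕ} (ht : 0 < t) :
    H.edgeSet.ncard ≤ t * (sparsify H t).edgeSet.ncard + t * Fintype.card W := by
  rw [ncard_edgeSet_eq, ncard_edgeSet_eq, card_edgePairs, card_edgePairs]
  calc ∑ v, (rightNbrs H v).card ≤ ∑ v, t * ((rightNbrs (sparsify H t) v).card + 1) :=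
        Finset.sum_le_sum fun v _ => card_rightNbrs_le H v ht
    _ = _ := by
        rw [← Finset.mul_sum, Finset.sum_add_distrib]
        simp [mul_add]

omit [Fintype W] in
/-- Replace an embedding on an open interval by an embedding into a large set. -/
lemma exists_reembed {V : Type*} [Fintype V] [LinearOrder V] (f : V ↪o W) {y₁ y₂ : V}
    {Z : Finset W} (hZ : ∀ z ∈ Z, f y₁ < z ∧ z < f y₂) (hc : Fintype.card V ≤ Z.card) :
    ∃ g : V ↪o W, (∀ v, ¬ (y₁ < v ∧ v < y₂) → g v = f v) ∧
      ∀ v, y₁ < v → v < y₂ → g v ∈ Z := by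
  classical
  let e : V ↪o W := ((Fintype.orderIsoFinOfCardEq V rfl).symm.toOrderEmbedding.trans
    (Fin.castLEOrderEmb hc)).trans (Z.orderEmbOfFin rfl)
  have he : ∀ v, e v ∈ Z := fun v => Finset.orderEmbOfFin_mem Z rfl _
  let g : V → W := fun v => if y₁ < v ∧ v < y₂ then e v else f v
  have hg : StrictMono g := by
    intro a b hab
    simp only [g]
    have hfa := f.strictMono hab
    have hea := e.strictMono hab
    split_ifs with h1 h2 h2
    · exact hea
    · have : y₂ ≤ b := by
        by_contra hlt
        exact h2 ⟨h1.1.trans hab, not_le.1 hlt⟩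
      exact (hZ _ (he a)).2.trans_le (f.monotone this)
    · have : a ≤ y₁ := by
        by_contra hlt
        exact h1 ⟨not_le.1 hlt, hab.trans h2.2⟩
      exact (f.monotone this).trans_lt (hZ _ (he b)).1
    · exact hfa
  refine ⟨OrderEmbedding.ofStrictMono g hg, fun v hv => ?_, fun v h1 h2 => ?_⟩
  · simp [g, hv]
  · simp [g, h1, h2, he]

variable {V : Type*} [Fintype V] [LinearOrder V] {G : SimpleGraph V}

/-- In a minimally non-linear graph, a vertex of degree one does not lie between two consecutive
non-isolated neighbours of its neighbour. -/
lemma MinNonlinear.no_insertion (hG : MinNonlinear G) {r y₁ y y₂ : V} (hr : r < y₁)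
    (h₁ : y₁ < y) (h₂ : y < y₂) (ha₁ : G.Adj r y₁) (ha : G.Adj r y) (ha₂ : G.Adj r y₂)
    (hdeg : ∀ b, G.Adj b y → b = r)
    (hiso : ∀ w b, G.Adj b w → y₁ < w → w < y₂ → w = y) : False := by
  classical
  obtain ⟨C, N, hlin⟩ := hG.linear_deleteEdge (e := s(r, y)) ha
  -- Between two kept neighbours there are at least `t - 1` further neighbours, enough room for all
  -- of `V`.
  set t := Fintype.card V + 1 with ht
  obtain ⟨n, hn, hlt⟩ := hG.not_linear (t * C + t) N
  refine absurd hlt (not_lt.2 (exOrd_le fun H hH => ?_))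
  have h1 : ¬ OrdContains (sparsify H t) (G.deleteEdges {s(r, y)}) := by
    rintro ⟨f, hf⟩
    refine hH ?_
    have hadj : ∀ a b, G.Adj a b → a ≠ y → b ≠ y → (sparsify H t).Adj (f a) (f b) := by
      intro a b hab hay hby
      refine hf a b ((SimpleGraph.deleteEdges_adj).2 ⟨hab, fun h => ?_⟩)
      rw [Set.mem_singleton_iff, Sym2.eq_iff] at h
      rcases h with h | h
      · exact hby h.2
      · exact hay h.1
    have k₁ := hadj r y₁ ha₁ (hr.trans h₁).ne h₁.ne
    have k₂ := hadj r y₂ ha₂ (hr.trans h₁).ne h₂.ne'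
    have hr₁ : f r < f y₁ := f.strictMono hr
    have hr₂ : f r < f y₂ := f.strictMono (hr.trans (h₁.trans h₂))
    rw [sparsify_adj hr₁] at k₁
    rw [sparsify_adj hr₂] at k₂
    have hb : beyond H (f r) (f y₂) < beyond H (f r) (f y₁) :=
      beyond_lt (f.strictMono (h₁.trans h₂)) (mem_rightNbrs.2 ⟨hr₂, k₂.1⟩)
    have hb' : beyond H (f r) (f y₂) + t ≤ beyond H (f r) (f y₁) := by
      have := Nat.le_of_dvd (Nat.sub_pos_of_lt hb) (Nat.dvd_sub k₁.2.1 k₂.2.1)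
      omega
    set Z := (rightNbrs H (f r)).filter fun z => f y₁ < z ∧ z < f y₂ with hZdef
    have hsub : (rightNbrs H (f r)).filter (fun z' => f y₁ < z') ⊆
        insert (f y₂) (Z ∪ (rightNbrs H (f r)).filter fun z' => f y₂ < z') := by
      intro z hz
      simp only [Finset.mem_filter] at hz
      simp only [Finset.mem_insert, Finset.mem_union, Finset.mem_filter, hZdef]
      rcases lt_trichotomy z (f y₂) with h | h | h
      · exact Or.inr (Or.inl ⟨hz.1, hz.2, h⟩)
      · exact Or.inl h
      · exact Or.inr (Or.inr ⟨hz.1, h⟩)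
    have hcard : Fintype.card V ≤ Z.card := by
      have q1 := Finset.card_le_card hsub
      have q2 := Finset.card_insert_le (f y₂)
        (Z ∪ (rightNbrs H (f r)).filter fun z' => f y₂ < z')
      have q3 := Finset.card_union_le Z ((rightNbrs H (f r)).filter fun z' => f y₂ < z')
      have q4 : beyond H (f r) (f y₁) =
        ((rightNbrs H (f r)).filter fun z' => f y₁ < z').card := rfl
      have q5 : beyond H (f r) (f y₂) =
        ((rightNbrs H (f r)).filter fun z' => f y₂ < z').card := rfl
      omega
    -- Only `y` carries edges inside the interval, so moving the whole interval onto neighbours of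
    -- `f r` loses no other edge and restores the deleted one.
    obtain ⟨g, hg₁, hg₂⟩ := exists_reembed f (Z := Z) (y₁ := y₁) (y₂ := y₂)
      (fun z hz => (Finset.mem_filter.1 hz).2) hcard
    have hgr : g r = f r := hg₁ r fun h => h.1.not_gt hr
    have hgy : H.Adj (f r) (g y) :=
      (mem_rightNbrs.1 (Finset.mem_filter.1 (hg₂ y h₁ h₂)).1).2
    refine ⟨g, fun a b hab => ?_⟩
    by_cases hay : a = y
    · subst hay
      rw [hdeg b hab.symm, hgr]
      exact hgy.symm
    by_cases hby : b = y
    · subst hby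
      rw [hdeg a hab, hgr]
      exact hgy
    rw [hg₁ a fun h => hay (hiso a b hab.symm h.1 h.2),
      hg₁ b fun h => hby (hiso b a hab h.1 h.2)]
    exact sparsify_le H t (hadj a b hab hay hby)
  have h2 := hlin n hn _ h1
  have h3 := ncard_le_sparsify H (t := t) (by omega)
  rw [Fintype.card_fin] at h3
  calc H.edgeSet.ncard ≤ t * (sparsify H t).edgeSet.ncard + t * n := h3
    _ ≤ t * (C * n) + t * n := by gcongr
    _ = (t * C + t) * n := by ring

end Insertion

/-! ### Hosts whose edges have power-of-two length -/

section PowerHosts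

/-- Distinct powers of two differ by a factor of at least two. Hence `y` is at most the midpoint of
`r` and `y'`, while `s'` is at least the midpoint of `s` and `x`, which is no smaller. -/
lemma pow_core {r s s' y y' x p q u v : ℕ} (h1 : r + 2 ^ p = y) (h2 : r + 2 ^ q = y')
    (h3 : s + 2 ^ u = x) (h4 : s' + 2 ^ v = x) (hrs : r ≤ s) (hss : s < s') (hyy : y < y')
    (hyx : y' ≤ x) : y ≤ s' := by
  have a1 : p < q := (Nat.pow_lt_pow_iff_right (by norm_num : 1 < 2)).1 (by omega)
  have a2 : v < u := (Nat.pow_lt_pow_iff_right (by norm_num : 1 < 2)).1 (by omega)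
  have a3 : 2 ^ (p + 1) ≤ 2 ^ q := Nat.pow_le_pow_right (by norm_num) a1
  have a4 : 2 ^ (v + 1) ≤ 2 ^ u := Nat.pow_le_pow_right (by norm_num) a2
  rw [pow_succ] at a3 a4
  omega

lemma pow_add_lt {K i k : ℕ} (hi : i < 2 ^ K) (hk : k < K + 1) : i + 2 ^ k < 2 ^ (K + 1) := by
  have : 2 ^ k ≤ 2 ^ K := Nat.pow_le_pow_right (by norm_num) (by omega)
  rw [pow_succ]
  omega

variable {V : Type*} [Fintype V] [LinearOrder V] {G : SimpleGraph V}

lemma MinNonlinear.ordered_power_host (hG : MinNonlinear G) {T : Finset (Sym2 V)}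
    (hT : T.card < G.edgeSet.ncard) :
    ∃ f : V → ℕ, StrictMono f ∧
      ∀ a b, a < b → G.Adj a b → s(a, b) ∈ T → ∃ k, f a + 2 ^ k = f b := by
  obtain ⟨C, N, h⟩ := hG.host hT
  -- Since `K + 1 > 2 * C`, the `2 ^ K * (K + 1)` edges exceed `C * 2 ^ (K + 1)`.
  set K := N + 2 * C with hK
  have hlt : K < 2 ^ K := Nat.lt_two_pow_self
  obtain ⟨f, hf, hfS⟩ := h (2 ^ (K + 1)) (by rw [pow_succ]; omega)
    ((Finset.range (2 ^ K) ×ˢ Finset.range (K + 1)).image fun q => (q.1, q.1 + 2 ^ q.2))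
    (fun p hp => by
      obtain ⟨⟨i, k⟩, hq, rfl⟩ := Finset.mem_image.1 hp
      simp only [Finset.mem_product, Finset.mem_range] at hq
      exact ⟨by simp, pow_add_lt hq.1 hq.2⟩)
    (by
      rw [Finset.card_image_of_injective, Finset.card_product, Finset.card_range,
        Finset.card_range, pow_succ]
      · nlinarith
      · rintro ⟨i, k⟩ ⟨i', k'⟩ heq
        simp only [Prod.mk.injEq] at heq
        obtain ⟨rfl, h2⟩ := heq
        have : k = k' := Nat.pow_right_injective (le_refl 2) (by simpa using h2)
        rw [this])
  refine ⟨f, hf, fun a b hab hadj hT => ?_⟩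
  obtain ⟨⟨i, k⟩, -, heq⟩ := Finset.mem_image.1 (hfS a b hab hadj hT)
  simp only [Prod.mk.injEq] at heq
  exact ⟨k, by rw [← heq.1, ← heq.2]⟩

/-- Placing rows and columns in disjoint blocks lets each block be permuted independently; `ρ` and
`γ` will be the identity or the reversal. -/
lemma MinNonlinear.matrix_power_host (hG : MinNonlinear G) {T : Finset (Sym2 V)}
    (hT : T.card < G.edgeSet.ncard) (ρ γ : ℕ → ℕ → ℕ)
    (hρ : ∀ m i, i < m → ρ m i < m) (hγ : ∀ m i, i < m → γ m i < m)
    (hρi : ∀ m i j, i < m → j < m → ρ m i = ρ m j → i = j)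
    (hγi : ∀ m i j, i < m → j < m → γ m i = γ m j → i = j) :
    ∃ (m : ℕ) (f : V → ℕ), StrictMono f ∧
      ∀ a b, a < b → G.Adj a b → s(a, b) ∈ T →
        ∃ i k, i + 2 ^ k < m ∧ f a = ρ m i ∧ f b = m + γ m (i + 2 ^ k) := by
  obtain ⟨C, N, h⟩ := hG.host hT
  set K := N + 4 * C with hK
  have hlt : K < 2 ^ K := Nat.lt_two_pow_self
  set m := 2 ^ (K + 1) with hm
  obtain ⟨f, hf, hfS⟩ := h (2 * m) (by rw [hm, pow_succ]; omega)
    ((Finset.range (2 ^ K) ×ˢ Finset.range (K + 1)).image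
      fun q => (ρ m q.1, m + γ m (q.1 + 2 ^ q.2)))
    (fun p hp => by
      obtain ⟨⟨i, k⟩, hq, rfl⟩ := Finset.mem_image.1 hp
      simp only [Finset.mem_product, Finset.mem_range] at hq
      have h0 := pow_add_lt hq.1 hq.2
      have h1 := hρ m i (by omega)
      have h2 := hγ m (i + 2 ^ k) h0
      exact ⟨by simp only; omega, by simp only; omega⟩)
    (by
      rw [Finset.card_image_of_injOn, Finset.card_product, Finset.card_range,
        Finset.card_range, hm, pow_succ]
      · nlinarith
      · rintro ⟨i, k⟩ hq ⟨i', k'⟩ hq' heq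
        simp only [Finset.coe_product, Set.mem_prod, Finset.mem_coe, Finset.mem_range] at hq hq'
        have h0 := pow_add_lt hq.1 hq.2
        have h0' := pow_add_lt hq'.1 hq'.2
        simp only [Prod.mk.injEq, Nat.add_left_cancel_iff] at heq
        obtain rfl := hρi m i i' (by omega) (by omega) heq.1
        have h2 := hγi m _ _ h0 h0' heq.2
        have : k = k' := Nat.pow_right_injective (le_refl 2) (by simpa using h2)
        rw [this])
  refine ⟨m, f, hf, fun a b hab hadj hT => ?_⟩
  obtain ⟨⟨i, k⟩, hq, heq⟩ := Finset.mem_image.1 (hfS a b hab hadj hT)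
  simp only [Finset.mem_product, Finset.mem_range] at hq
  simp only [Prod.mk.injEq] at heq
  exact ⟨i, k, pow_add_lt hq.1 hq.2, heq.1.symm, heq.2.symm⟩

/-- With rows and columns on one line, the embedding preserves `s' < y`, against `pow_core`. -/
lemma MinNonlinear.no_pp (hG : MinNonlinear G) {r s s' y y' x : V}
    (hc : ({s(r, y), s(r, y'), s(s, x), s(s', x)} : Finset (Sym2 V)).card < G.edgeSet.ncard)
    (hrs : r ≤ s) (hss : s < s') (hyy : y < y') (hyx : y' ≤ x) (hsy : s' < y)
    (h1 : G.Adj r y) (h2 : G.Adj r y') (h3 : G.Adj s x) (h4 : G.Adj s' x) : False := by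
  obtain ⟨f, hf, h⟩ := hG.ordered_power_host hc
  have l1 : r < y := (hrs.trans_lt hss).trans hsy
  have l3 : s' < x := hsy.trans (hyy.trans_le hyx)
  obtain ⟨p, e1⟩ := h r y l1 h1 (by simp)
  obtain ⟨q, e2⟩ := h r y' (l1.trans hyy) h2 (by simp)
  obtain ⟨u, e3⟩ := h s x (hss.trans l3) h3 (by simp)
  obtain ⟨v, e4⟩ := h s' x l3 h4 (by simp)
  exact absurd (pow_core e1 e2 e3 e4 (hf.monotone hrs) (hf hss) (hf hyy) (hf.monotone hyx))
    (not_le.2 (hf hsy))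

/-- In separate blocks the order no longer compares the indices of `s'` and `y`. The fifth edge
does: a column index exceeds the row index of each of its entries, so the indices satisfy `s' ≤ t <
z ≤ y`. The same device serves `no_mm` and `no_pm`. -/
lemma MinNonlinear.no_mp (hG : MinNonlinear G) (he : 5 < G.edgeSet.ncard) {r s s' y y' x t z : V}
    (hrs : s ≤ r) (hss : s' < s) (hyy : y < y') (hyx : y' ≤ x) (hts : t ≤ s') (hzy : z ≤ y)
    (hrz : r < z) (h1 : G.Adj r y) (h2 : G.Adj r y') (h3 : G.Adj s x) (h4 : G.Adj s' x)
    (h5 : G.Adj t z) : False := by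
  obtain ⟨m, f, hf, h⟩ := hG.matrix_power_host
    (T := {s(r, y), s(r, y'), s(s, x), s(s', x), s(t, z)})
    (lt_of_le_of_lt Finset.card_le_five he)
    (fun m i => m - 1 - i) (fun _ i => i) (by omega) (by omega) (by omega) (by omega)
  have ly : r < y := hrz.trans_le hzy
  have lx : r < x := ly.trans (hyy.trans_le hyx)
  obtain ⟨i1, p, b1, e1, e1'⟩ := h r y ly h1 (by simp)
  obtain ⟨i2, q, b2, e2, e2'⟩ := h r y' (ly.trans hyy) h2 (by simp)
  obtain ⟨i3, u, b3, e3, e3'⟩ := h s x (hrs.trans_lt lx) h3 (by simp)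
  obtain ⟨i4, v, b4, e4, e4'⟩ := h s' x ((hss.trans_le hrs).trans lx) h4 (by simp)
  obtain ⟨i5, w, b5, e5, e5'⟩ := h t z (((hts.trans_lt hss).trans_le hrs).trans hrz) h5 (by simp)
  have g1 := hf.monotone hrs
  have g2 := hf hss
  have g3 := hf hyy
  have g4 := hf.monotone hyx
  have g5 := hf.monotone hts
  have g6 := hf.monotone hzy
  have hi : i2 = i1 := by omega
  subst hi
  have := pow_core (r := i2) (s := i3) (s' := i4) (p := p) (q := q) (u := u) (v := v)
    rfl rfl rfl (by omega)
    (by omega) (by omega) (by omega) (by omega)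
  have := Nat.two_pow_pos w
  omega

lemma MinNonlinear.no_mm (hG : MinNonlinear G) (he : 5 < G.edgeSet.ncard) {r s s' y y' x t z : V}
    (hrs : s ≤ r) (hss : s' < s) (hyy : y' < y) (hyx : x ≤ y') (hts : t ≤ s') (hzy : y ≤ z)
    (hrx : r < x) (h1 : G.Adj r y) (h2 : G.Adj r y') (h3 : G.Adj s x) (h4 : G.Adj s' x)
    (h5 : G.Adj t z) : False := by
  obtain ⟨m, f, hf, h⟩ := hG.matrix_power_host
    (T := {s(r, y), s(r, y'), s(s, x), s(s', x), s(t, z)})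
    (lt_of_le_of_lt Finset.card_le_five he)
    (fun m i => m - 1 - i) (fun m i => m - 1 - i) (by omega) (by omega) (by omega) (by omega)
  have ly : r < y' := hrx.trans_le hyx
  obtain ⟨i1, p, b1, e1, e1'⟩ := h r y (ly.trans hyy) h1 (by simp)
  obtain ⟨i2, q, b2, e2, e2'⟩ := h r y' ly h2 (by simp)
  obtain ⟨i3, u, b3, e3, e3'⟩ := h s x (hrs.trans_lt hrx) h3 (by simp)
  obtain ⟨i4, v, b4, e4, e4'⟩ := h s' x ((hss.trans_le hrs).trans hrx) h4 (by simp)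
  obtain ⟨i5, w, b5, e5, e5'⟩ := h t z
    (((hts.trans_lt hss).trans_le hrs).trans ((ly.trans hyy).trans_le hzy)) h5 (by simp)
  have g1 := hf.monotone hrs
  have g2 := hf hss
  have g3 := hf hyy
  have g4 := hf.monotone hyx
  have g5 := hf.monotone hts
  have g6 := hf.monotone hzy
  have hi : i2 = i1 := by omega
  subst hi
  have := pow_core (r := i2) (s := i3) (s' := i4) (p := p) (q := q) (u := u) (v := v)
    rfl rfl rfl (by omega)
    (by omega) (by omega) (by omega) (by omega)
  have := Nat.two_pow_pos w
  omega

lemma MinNonlinear.no_pm (hG : MinNonlinear G) (he : 5 < G.edgeSet.ncard) {r s s' y y' x t z : V}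
    (hrs : r ≤ s) (hss : s < s') (hyy : y' < y) (hyx : x ≤ y') (hts : s' ≤ t) (hzy : y ≤ z)
    (htx : t < x) (h1 : G.Adj r y) (h2 : G.Adj r y') (h3 : G.Adj s x) (h4 : G.Adj s' x)
    (h5 : G.Adj t z) : False := by
  obtain ⟨m, f, hf, h⟩ := hG.matrix_power_host
    (T := {s(r, y), s(r, y'), s(s, x), s(s', x), s(t, z)})
    (lt_of_le_of_lt Finset.card_le_five he)
    (fun _ i => i) (fun m i => m - 1 - i) (by omega) (by omega) (by omega) (by omega)
  have ls : s' < x := hts.trans_lt htx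
  have lr : r < y' := ((hrs.trans_lt hss).trans ls).trans_le hyx
  obtain ⟨i1, p, b1, e1, e1'⟩ := h r y (lr.trans hyy) h1 (by simp)
  obtain ⟨i2, q, b2, e2, e2'⟩ := h r y' lr h2 (by simp)
  obtain ⟨i3, u, b3, e3, e3'⟩ := h s x (hss.trans ls) h3 (by simp)
  obtain ⟨i4, v, b4, e4, e4'⟩ := h s' x ls h4 (by simp)
  obtain ⟨i5, w, b5, e5, e5'⟩ := h t z (htx.trans_le ((hyx.trans hyy.le).trans hzy)) h5 (by simp)
  have g1 := hf.monotone hrs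
  have g2 := hf hss
  have g3 := hf hyy
  have g4 := hf.monotone hyx
  have g5 := hf.monotone hts
  have g6 := hf.monotone hzy
  have hi : i2 = i1 := by omega
  subst hi
  have := pow_core (r := i2) (s := i3) (s' := i4) (p := p) (q := q) (u := u) (v := v)
    rfl rfl rfl (by omega)
    (by omega) (by omega) (by omega) (by omega)
  have := Nat.two_pow_pos w
  omega

end PowerHosts

set_option linter.unusedSectionVars false

/-! ### Alternation-free matrices: the composition of two layers -/

section Alternation

/-- A sparse matrix with rows `ρ` and columns `κ` in which no larger row alternates twice with a
smaller one. The first entry of each row lies in a live column, all entries of a live column are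
first entries, and each live column has `m` entries. Each row has more than `k` entries. -/
structure Layered (ρ κ : Type) [Fintype ρ] [LinearOrder ρ] [LinearOrder κ] (k m F : ℕ) where
  E : ρ → κ → Prop
  fan : ρ → κ
  live : Finset κ
  dead : Finset κ
  E_fan : ∀ y, E y (fan y)
  mem_of_E : ∀ y c, E y c → c ∈ live ∨ c ∈ dead
  eq_fan : ∀ y c, E y c → c ∈ live → c = fan y
  fan_mem : ∀ y, fan y ∈ live
  fan_le : ∀ y c, E y c → fan y ≤ c
  alt : ∀ a b c₁ c₂ c₃ c₄, b < a → E a c₁ → E b c₂ → E a c₃ → E b c₄ →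
    c₁ < c₂ → c₂ < c₃ → c₃ < c₄ → False
  mates : ∀ a b c c', b < a → fan a = fan b → E a c → E b c' → fan a < c → c < c' → False
  fiber : ∀ c ∈ live, (Finset.univ.filter fun y => fan y = c).card = m
  ones : ∀ y, ∃ s : Finset κ, k + 1 ≤ s.card ∧ ∀ c ∈ s, E y c
  live_pos : 0 < live.card
  le_live : 0 < k → F ≤ live.card
  dead_le : F * dead.card ≤ k * Fintype.card ρ

lemma exists_strictMonoOn {α β : Type*} [LinearOrder α] [LinearOrder β] (A : Finset α)
    (B : Finset β) (h : A.card = B.card) (hB : B.Nonempty) :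
    ∃ g : α → β, (∀ a ∈ A, g a ∈ B) ∧ (∀ a ∈ A, ∀ a' ∈ A, a < a' → g a < g a') ∧
      ∀ b ∈ B, ∃ a ∈ A, g a = b := by
  classical
  let e : A ≃o B := (A.orderIsoOfFin h).symm.trans (B.orderIsoOfFin rfl)
  obtain ⟨b₀, -⟩ := hB
  refine ⟨fun a => if ha : a ∈ A then (e ⟨a, ha⟩ : β) else b₀, fun a ha => ?_,
    fun a ha a' ha' hlt => ?_, fun b hb => ?_⟩
  · simp [ha]
  · simp only [ha, ha', dif_pos]
    exact e.strictMono (show (⟨a, ha⟩ : A) < ⟨a', ha'⟩ from hlt)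
  · exact ⟨e.symm ⟨b, hb⟩, (e.symm ⟨b, hb⟩).2, by simp⟩

namespace Layered

/-- Every live column has exactly `B.card` entries, so the rows starting in it can be matched with
`B` in increasing order. -/
lemma exists_spread {ρ κ κ' : Type} [Fintype ρ] [LinearOrder ρ] [LinearOrder κ]
    [LinearOrder κ'] {k F : ℕ} (B : Finset κ') (hB : B.Nonempty)
    (T : Layered ρ κ k B.card F) :
    ∃ σ : ρ → κ', (∀ y, σ y ∈ B) ∧ (∀ y y', T.fan y = T.fan y' → y < y' → σ y < σ y') ∧
      ∀ c ∈ T.live, ∀ d ∈ B, ∃ y, T.fan y = c ∧ σ y = d := by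
  classical
  have h : ∀ c, ∃ g : ρ → κ', c ∈ T.live →
      (∀ y, T.fan y = c → g y ∈ B) ∧
      (∀ y, T.fan y = c → ∀ y', T.fan y' = c → y < y' → g y < g y') ∧
      ∀ d ∈ B, ∃ y, T.fan y = c ∧ g y = d := by
    intro c
    by_cases hc : c ∈ T.live
    · obtain ⟨g, hg⟩ := exists_strictMonoOn _ B (T.fiber c hc) hB
      exact ⟨g, fun _ => by simpa using hg⟩
    · exact ⟨fun _ => hB.choose, fun h => absurd h hc⟩
  choose g hg using h
  refine ⟨fun y => g (T.fan y) y, fun y => (hg _ (T.fan_mem y)).1 y rfl, fun y y' hyy hlt => ?_,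
    fun c hc d hd => ?_⟩
  · have := (hg _ (T.fan_mem y)).2.1 y rfl y' hyy.symm hlt
    simp only
    rwa [hyy] at this ⊢
  · obtain ⟨y, hy, hd⟩ := (hg c hc).2.2 d hd
    exact ⟨y, hy, by simp only [hy]; exact hd⟩

/-- The matrix with a single column. -/
def base (m F : ℕ) : Layered (Fin m) Unit 0 m F where
  E _ _ := True
  fan _ := ()
  live := {()}
  dead := ∅
  E_fan _ := trivial
  mem_of_E _ _ _ := by simp
  eq_fan _ _ _ _ := rfl
  fan_mem _ := by simp
  fan_le _ _ _ := le_rfl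
  alt _ _ _ _ _ _ _ _ _ _ _ h _ _ := lt_irrefl _ h
  mates _ _ _ _ _ _ _ _ h _ := lt_irrefl _ h
  fiber c _ := by simp
  ones _ := ⟨{()}, by simp, by simp⟩
  live_pos := by simp
  le_live h := absurd h (lt_irrefl _)
  dead_le := by simp

/-- The matrix without rows. -/
def noRows (k F : ℕ) : Layered (Fin 0) (Fin (F + 1)) k 0 F where
  E _ _ := False
  fan y := y.elim0
  live := Finset.univ
  dead := ∅
  E_fan y := y.elim0
  mem_of_E y := y.elim0
  eq_fan y := y.elim0
  fan_mem y := y.elim0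
  fan_le y := y.elim0
  alt y := y.elim0
  mates y := y.elim0
  fiber c _ := by simp
  ones y := y.elim0
  live_pos := by simp
  le_live _ := by simp
  dead_le := by simp

variable {ρ₀ κ₀ ρ₁ κ₁ : Type} [Fintype ρ₀] [LinearOrder ρ₀] [LinearOrder κ₀]
  [Fintype ρ₁] [LinearOrder ρ₁] [LinearOrder κ₁] {k m F : ℕ}

abbrev StepRow (T₀ : Layered ρ₀ κ₀ k m F) (ρ₁ : Type) : Type := (T₀.live ×ₗ ρ₁) ⊕ₗ ρ₀

abbrev StepRow.old (T₀ : Layered ρ₀ κ₀ k m F) (c : T₀.live) (x : ρ₁) : StepRow T₀ ρ₁ :=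
  toLex (Sum.inl (toLex (c, x)))

abbrev StepRow.new (T₀ : Layered ρ₀ κ₀ k m F) (ρ₁ : Type) (y : ρ₀) : StepRow T₀ ρ₁ :=
  toLex (Sum.inr y)

lemma StepRow.cases {T₀ : Layered ρ₀ κ₀ k m F} {p : StepRow T₀ ρ₁ → Prop}
    (h₁ : ∀ c x, p (StepRow.old T₀ c x)) (h₂ : ∀ y, p (StepRow.new T₀ ρ₁ y)) (y) : p y :=
  match y with
  | Sum.inl x => h₁ x.1 x.2
  | Sum.inr y => h₂ y

lemma StepRow.old_lt_old {T₀ : Layered ρ₀ κ₀ k m F} {c c' : T₀.live} {x x' : ρ₁} :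
    StepRow.old T₀ c x < StepRow.old T₀ c' x' ↔ c < c' ∨ c = c' ∧ x < x' := by
  simp [StepRow.old, Prod.Lex.toLex_lt_toLex]

lemma StepRow.new_lt_new {T₀ : Layered ρ₀ κ₀ k m F} {y y' : ρ₀} :
    StepRow.new T₀ ρ₁ y < StepRow.new T₀ ρ₁ y' ↔ y < y' := by
  simp [StepRow.new]

lemma StepRow.not_new_lt_old {T₀ : Layered ρ₀ κ₀ k m F} {c : T₀.live} {x : ρ₁} {y : ρ₀} :
    ¬ StepRow.new T₀ ρ₁ y < StepRow.old T₀ c x := by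
  simp [StepRow.new, StepRow.old]

lemma lexCol_cases {p : κ₀ ×ₗ WithTop κ₁ → Prop} (h : ∀ c d, p (toLex (c, d))) (c) : p c :=
  h c.1 c.2

/-- Each column of `T₀` becomes a block of columns of `T₁` followed by a top column, and the blocks
of live columns are filled with copies of `T₁`. A row of `T₀` moves its entries to the top columns
and gains a new first entry in a live column of a copy. -/
def stepE (T₁ : Layered ρ₁ κ₁ (k + 1) m F) (T₀ : Layered ρ₀ κ₀ k T₁.live.card F)
    (σ : ρ₀ → κ₁) : StepRow T₀ ρ₁ → κ₀ ×ₗ WithTop κ₁ → Prop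
  | Sum.inl x, c => c.1 = x.1 ∧ ∃ d : κ₁, c.2 = d ∧ T₁.E x.2 d
  | Sum.inr y, c => (c.1 = T₀.fan y ∧ c.2 = σ y) ∨ (c.2 = ⊤ ∧ T₀.E y c.1)

def stepFan (T₁ : Layered ρ₁ κ₁ (k + 1) m F) (T₀ : Layered ρ₀ κ₀ k T₁.live.card F)
    (σ : ρ₀ → κ₁) : StepRow T₀ ρ₁ → κ₀ ×ₗ WithTop κ₁
  | Sum.inl x => toLex ((x.1 : κ₀), ((T₁.fan x.2 : κ₁) : WithTop κ₁))
  | Sum.inr y => toLex (T₀.fan y, ((σ y : κ₁) : WithTop κ₁))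

section
variable {T₁ : Layered ρ₁ κ₁ (k + 1) m F} {T₀ : Layered ρ₀ κ₀ k T₁.live.card F} {σ : ρ₀ → κ₁}

lemma stepE_old {c : T₀.live} {x : ρ₁} {c' : κ₀} {d : WithTop κ₁} :
    stepE T₁ T₀ σ (StepRow.old T₀ c x) (toLex (c', d)) ↔
      c' = c ∧ ∃ d' : κ₁, d = d' ∧ T₁.E x d' := Iff.rfl

lemma stepE_new {y : ρ₀} {c' : κ₀} {d : WithTop κ₁} :
    stepE T₁ T₀ σ (StepRow.new T₀ ρ₁ y) (toLex (c', d)) ↔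
      (c' = T₀.fan y ∧ d = σ y) ∨ (d = ⊤ ∧ T₀.E y c') := Iff.rfl

lemma stepFan_old {c : T₀.live} {x : ρ₁} :
    stepFan T₁ T₀ σ (StepRow.old T₀ c x) = toLex ((c : κ₀), ((T₁.fan x : κ₁) : WithTop κ₁)) := rfl

lemma stepFan_new {y : ρ₀} :
    stepFan T₁ T₀ σ (StepRow.new T₀ ρ₁ y) = toLex (T₀.fan y, ((σ y : κ₁) : WithTop κ₁)) := rfl

lemma toLex_lt' {c c' : κ₀} {d d' : WithTop κ₁} :
    toLex (c, d) < toLex (c', d') ↔ c < c' ∨ c = c' ∧ d < d' := Prod.Lex.toLex_lt_toLex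

lemma toLex_le' {c c' : κ₀} {d d' : WithTop κ₁} :
    toLex (c, d) ≤ toLex (c', d') ↔ c < c' ∨ c = c' ∧ d ≤ d' := Prod.Lex.toLex_le_toLex

lemma stepFan_le (y : StepRow T₀ ρ₁) : ∀ c, stepE T₁ T₀ σ y c → stepFan T₁ T₀ σ y ≤ c := by
  induction y using StepRow.cases with
  | h₁ c₀ x =>
    refine lexCol_cases fun c d h => ?_
    rw [stepE_old] at h
    obtain ⟨rfl, d', rfl, h⟩ := h
    rw [stepFan_old, toLex_le']
    exact Or.inr ⟨rfl, WithTop.coe_le_coe.2 (T₁.fan_le _ _ h)⟩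
  | h₂ y =>
    refine lexCol_cases fun c d h => ?_
    rw [stepE_new] at h
    rw [stepFan_new, toLex_le']
    rcases h with ⟨rfl, rfl⟩ | ⟨rfl, h⟩
    · exact Or.inr ⟨rfl, le_rfl⟩
    · rcases (T₀.fan_le _ _ h).lt_or_eq with h | h
      · exact Or.inl h
      · exact Or.inr ⟨h, le_top⟩

/-- An entry of a new row that is not its first one lies in a top column. -/
lemma stepE_new_of_lt {y : ρ₀} {c : κ₀} {d : WithTop κ₁}
    (h : stepE T₁ T₀ σ (StepRow.new T₀ ρ₁ y) (toLex (c, d)))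
    (hlt : stepFan T₁ T₀ σ (StepRow.new T₀ ρ₁ y) < toLex (c, d)) : d = ⊤ ∧ T₀.E y c := by
  rw [stepE_new] at h
  rcases h with ⟨rfl, rfl⟩ | h
  · exact absurd hlt (by rw [stepFan_new]; exact lt_irrefl _)
  · exact h

lemma E_of_stepE_new {y : ρ₀} {c : κ₀} {d : WithTop κ₁}
    (h : stepE T₁ T₀ σ (StepRow.new T₀ ρ₁ y) (toLex (c, d))) : T₀.E y c := by
  rw [stepE_new] at h
  rcases h with ⟨rfl, rfl⟩ | h
  · exact T₀.E_fan y
  · exact h.2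

/-- Two old rows can alternate only within one copy of `T₁`. An old row cannot straddle a top
column, where the third entry of the pattern lies if `a` is new. Two new rows alternate already in
`T₀` unless columns merge: `c₁ = c₂` is excluded by `mates`, and `c₂ = c₃` by monotonicity of `σ`.
-/
lemma step_alt (hσ : ∀ y y', T₀.fan y = T₀.fan y' → y < y' → σ y < σ y')
    (a b : StepRow T₀ ρ₁) : ∀ c₁ c₂ c₃ c₄, b < a → stepE T₁ T₀ σ a c₁ → stepE T₁ T₀ σ b c₂ →
      stepE T₁ T₀ σ a c₃ → stepE T₁ T₀ σ b c₄ → c₁ < c₂ → c₂ < c₃ → c₃ < c₄ → False := by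
  refine lexCol_cases fun c₁ d₁ => lexCol_cases fun c₂ d₂ => lexCol_cases fun c₃ d₃ =>
    lexCol_cases fun c₄ d₄ hba h1 h2 h3 h4 l12 l23 l34 => ?_
  have f1 := (stepFan_le _ _ h1).trans_lt (l12.trans l23)
  have f2 := (stepFan_le _ _ h2).trans_lt (l23.trans l34)
  induction a using StepRow.cases with
  | h₁ c x =>
    induction b using StepRow.cases with
    | h₁ c' x' =>
      rw [stepE_old] at h1 h2 h3 h4
      rw [StepRow.old_lt_old] at hba
      obtain ⟨rfl, e1, rfl, h1⟩ := h1
      obtain ⟨e, e2, rfl, h2⟩ := h2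
      obtain ⟨rfl, e3, rfl, h3⟩ := h3
      obtain ⟨rfl, e4, rfl, h4⟩ := h4
      rw [toLex_lt'] at l12 l23 l34
      subst e
      have hcc : (c : κ₀) = c' := by
        rcases l12 with l | l
        · rcases l23 with l' | l'
          · exact absurd l l'.not_gt
          · exact l'.1.symm
        · exact l.1
      have hcc' : c' = c := Subtype.ext hcc.symm
      subst hcc'
      simp only [lt_irrefl, false_or, true_and, WithTop.coe_lt_coe] at *
      exact T₁.alt _ _ _ _ _ _ hba h1 h2 h3 h4 l12 l23 l34
    | h₂ y => exact StepRow.not_new_lt_old hba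
  | h₂ y =>
    obtain ⟨rfl, k3⟩ := stepE_new_of_lt h3 f1
    induction b using StepRow.cases with
    | h₁ c' x' =>
      rw [stepE_old] at h2 h4
      obtain ⟨rfl, e2, rfl, h2⟩ := h2
      obtain ⟨rfl, e4, rfl, h4⟩ := h4
      rw [toLex_lt'] at l23 l34
      rcases l34 with l | l
      · rcases l23 with l' | l'
        · exact absurd l l'.not_gt
        · exact absurd l'.1 l.ne'
      · exact absurd l.2 not_top_lt
    | h₂ y' =>
      rw [StepRow.new_lt_new] at hba
      obtain ⟨rfl, k4⟩ := stepE_new_of_lt h4 f2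
      have k1 := E_of_stepE_new h1
      have k2 := E_of_stepE_new h2
      rw [toLex_lt'] at l12 l23 l34
      have m34 : c₃ < c₄ := by
        rcases l34 with l | l
        · exact l
        · exact absurd l.2 (lt_irrefl _)
      rcases l23 with l23 | ⟨rfl, l23⟩
      · rcases l12 with l12 | ⟨rfl, l12⟩
        · exact T₀.alt _ _ _ _ _ _ hba k1 k2 k3 k4 l12 l23 m34
        · rw [stepE_new] at h1
          rcases h1 with ⟨rfl, rfl⟩ | ⟨rfl, -⟩
          · have := T₀.eq_fan _ _ k2 (T₀.fan_mem y)
            exact T₀.mates _ _ _ _ hba this k3 k4 l23 m34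
          · exact absurd l12 not_top_lt
      · rw [stepE_new] at h2
        rcases h2 with ⟨rfl, rfl⟩ | ⟨rfl, -⟩
        · have hyf := T₀.eq_fan _ _ k3 (T₀.fan_mem y')
          have hle := T₀.fan_le _ _ k1
          have hc1 : c₁ = T₀.fan y' ∧ d₁ < σ y' := by
            rcases l12 with l | l
            · exact absurd l (by rw [hyf]; exact hle.not_gt)
            · exact l
          rw [stepE_new] at h1
          rcases h1 with ⟨-, rfl⟩ | ⟨rfl, -⟩
          · exact absurd (WithTop.coe_lt_coe.1 hc1.2) (hσ _ _ hyf hba).not_gt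
          · exact absurd hc1.2 not_top_lt
        · exact absurd l23 (lt_irrefl _)

/-- New rows never share a first column, since `σ` is strictly increasing on fibres. The later
entries of a new row lie in top columns, beyond every entry of an old row with the same first
column. -/
lemma step_mates (hσ : ∀ y y', T₀.fan y = T₀.fan y' → y < y' → σ y < σ y')
    (a b : StepRow T₀ ρ₁) : ∀ c c', b < a → stepFan T₁ T₀ σ a = stepFan T₁ T₀ σ b →
      stepE T₁ T₀ σ a c → stepE T₁ T₀ σ b c' → stepFan T₁ T₀ σ a < c → c < c' → False := by
  refine lexCol_cases fun c d => lexCol_cases fun c' d' hba hf h1 h2 l1 l2 => ?_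
  induction a using StepRow.cases with
  | h₁ c₀ x =>
    induction b using StepRow.cases with
    | h₁ c₁ x' =>
      rw [stepE_old] at h1 h2
      rw [StepRow.old_lt_old] at hba
      obtain ⟨rfl, e1, rfl, h1⟩ := h1
      obtain ⟨rfl, e2, rfl, h2⟩ := h2
      rw [stepFan_old] at hf l1
      rw [stepFan_old] at hf
      simp only [EmbeddingLike.apply_eq_iff_eq, Prod.mk.injEq, WithTop.coe_inj] at hf
      obtain ⟨e, hf⟩ := hf
      have e' : c₁ = c₀ := Subtype.ext e.symm
      subst e'
      rw [toLex_lt'] at l1 l2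
      simp only [lt_irrefl, false_or, true_and, WithTop.coe_lt_coe] at *
      exact T₁.mates _ _ _ _ hba hf h1 h2 l1 l2
    | h₂ y => exact StepRow.not_new_lt_old hba
  | h₂ y =>
    obtain ⟨rfl, k1⟩ := stepE_new_of_lt h1 l1
    induction b using StepRow.cases with
    | h₁ c₁ x' =>
      rw [stepE_old] at h2
      obtain ⟨rfl, e2, rfl, h2⟩ := h2
      rw [stepFan_old, stepFan_new] at hf
      simp only [EmbeddingLike.apply_eq_iff_eq, Prod.mk.injEq] at hf
      have := T₀.fan_le _ _ k1
      rw [toLex_lt'] at l2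
      rcases l2 with l | l
      · rw [hf.1] at this
        exact absurd l this.not_gt
      · exact absurd l.2 not_top_lt
    | h₂ y' =>
      rw [StepRow.new_lt_new] at hba
      rw [stepFan_new, stepFan_new] at hf
      simp only [EmbeddingLike.apply_eq_iff_eq, Prod.mk.injEq, WithTop.coe_inj] at hf
      have := hσ _ _ hf.1.symm hba
      rw [hf.2] at this
      exact lt_irrefl _ this
end

end Layered

end Alternation

/-! ### Alternation-free matrices: recursion and density -/

section Alternation

namespace Layered

variable {ρ₀ κ₀ ρ₁ κ₁ : Type} [Fintype ρ₀] [LinearOrder ρ₀] [LinearOrder κ₀]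
  [Fintype ρ₁] [LinearOrder ρ₁] [LinearOrder κ₁] {k m F : ℕ}

variable (T₁ : Layered ρ₁ κ₁ (k + 1) m F) (T₀ : Layered ρ₀ κ₀ k T₁.live.card F)

def stepLive : Finset (κ₀ ×ₗ WithTop κ₁) :=
  (T₀.live ×ˢ T₁.live).image fun p => toLex (p.1, (p.2 : WithTop κ₁))

def stepDead : Finset (κ₀ ×ₗ WithTop κ₁) :=
  (T₀.live ×ˢ T₁.dead).image (fun p => toLex (p.1, (p.2 : WithTop κ₁))) ∪
    (T₀.live ∪ T₀.dead).image fun c => toLex (c, (⊤ : WithTop κ₁))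

variable {T₁ T₀}

lemma mem_stepLive {c : κ₀} {d : WithTop κ₁} :
    toLex (c, d) ∈ stepLive T₁ T₀ ↔ c ∈ T₀.live ∧ ∃ d' ∈ T₁.live, d = d' := by
  simp only [stepLive, Finset.mem_image, Finset.mem_product, EmbeddingLike.apply_eq_iff_eq,
    Prod.mk.injEq, Prod.exists]
  constructor
  · rintro ⟨a, b, ⟨h1, h2⟩, rfl, rfl⟩
    exact ⟨h1, b, h2, rfl⟩
  · rintro ⟨h1, b, h2, rfl⟩
    exact ⟨c, b, ⟨h1, h2⟩, rfl, rfl⟩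

lemma mem_stepDead {c : κ₀} {d : WithTop κ₁} :
    toLex (c, d) ∈ stepDead T₁ T₀ ↔ (c ∈ T₀.live ∧ ∃ d' ∈ T₁.dead, d = d') ∨
      ((c ∈ T₀.live ∨ c ∈ T₀.dead) ∧ d = ⊤) := by
  simp only [stepDead, Finset.mem_image, Finset.mem_product, EmbeddingLike.apply_eq_iff_eq,
    Prod.mk.injEq, Prod.exists, Finset.mem_union]
  refine or_congr ⟨?_, ?_⟩ ⟨?_, ?_⟩
  · rintro ⟨a, b, ⟨h1, h2⟩, rfl, rfl⟩
    exact ⟨h1, b, h2, rfl⟩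
  · rintro ⟨h1, b, h2, rfl⟩
    exact ⟨c, b, ⟨h1, h2⟩, rfl, rfl⟩
  · rintro ⟨a, h1, rfl, rfl⟩
    exact ⟨h1, rfl⟩
  · rintro ⟨h1, rfl⟩
    exact ⟨c, h1, rfl, rfl⟩

lemma card_stepLive : (stepLive T₁ T₀).card = T₀.live.card * T₁.live.card := by
  rw [stepLive, Finset.card_image_of_injective, Finset.card_product]
  rintro ⟨a, b⟩ ⟨a', b'⟩ h
  simpa using h

lemma card_stepDead : (stepDead T₁ T₀).card ≤
    T₀.live.card * T₁.dead.card + (T₀.live.card + T₀.dead.card) := by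
  refine (Finset.card_union_le _ _).trans (Nat.add_le_add ?_ ?_)
  · exact Finset.card_image_le.trans (Finset.card_product _ _).le
  · exact Finset.card_image_le.trans (Finset.card_union_le _ _)

lemma card_rows {ρ κ : Type} [Fintype ρ] [LinearOrder ρ] [LinearOrder κ]
    (T : Layered ρ κ k m F) : Fintype.card ρ = T.live.card * m := by
  rw [← Finset.card_univ, Finset.card_eq_sum_card_fiberwise (f := T.fan) (t := T.live)
    (fun y _ => T.fan_mem y), Finset.sum_congr rfl T.fiber]
  simp

/-- A live column keeps its `m` entries from the copy and gains exactly one new row. The top columns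
over live columns of `T₀` are affordable because `T₀` has `T₁.live.card ≥ F` rows for each of them.
-/
lemma exists_step (hF : F ≤ T₁.live.card) :
    Nonempty (Layered (StepRow T₀ ρ₁) (κ₀ ×ₗ WithTop κ₁) (k + 1) (m + 1) F) := by
  classical
  obtain ⟨σ, hσB, hσ, hσs⟩ := exists_spread T₁.live (Finset.card_pos.1 T₁.live_pos) T₀
  refine ⟨{
    E := stepE T₁ T₀ σ
    fan := stepFan T₁ T₀ σ
    live := stepLive T₁ T₀
    dead := stepDead T₁ T₀
    E_fan := StepRow.cases (fun c x => stepE_old.2 ⟨rfl, _, rfl, T₁.E_fan x⟩)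
      (fun y => stepE_new.2 (Or.inl ⟨rfl, rfl⟩))
    mem_of_E := ?_
    eq_fan := ?_
    fan_mem := StepRow.cases
      (fun c x => mem_stepLive.2 ⟨c.2, _, T₁.fan_mem x, rfl⟩)
      (fun y => mem_stepLive.2 ⟨T₀.fan_mem y, _, hσB y, rfl⟩)
    fan_le := stepFan_le
    alt := step_alt hσ
    mates := step_mates hσ
    fiber := ?_
    ones := ?_
    live_pos := by
      rw [card_stepLive]
      exact Nat.mul_pos T₀.live_pos T₁.live_pos
    le_live := fun _ => by
      rw [card_stepLive]
      exact hF.trans (Nat.le_mul_of_pos_left _ T₀.live_pos)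
    dead_le := ?_ }⟩
  · refine StepRow.cases (fun c₀ x => lexCol_cases fun c d h => ?_)
      (fun y => lexCol_cases fun c d h => ?_)
    · obtain ⟨rfl, d', rfl, hE⟩ := stepE_old.1 h
      rw [mem_stepLive, mem_stepDead]
      rcases T₁.mem_of_E _ _ hE with h | h
      · exact Or.inl ⟨c₀.2, _, h, rfl⟩
      · exact Or.inr (Or.inl ⟨c₀.2, _, h, rfl⟩)
    · rw [mem_stepLive, mem_stepDead]
      rcases stepE_new.1 h with ⟨rfl, rfl⟩ | ⟨rfl, hE⟩
      · exact Or.inl ⟨T₀.fan_mem y, _, hσB y, rfl⟩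
      · exact Or.inr (Or.inr ⟨T₀.mem_of_E _ _ hE, rfl⟩)
  · refine StepRow.cases (fun c₀ x => lexCol_cases fun c d h h' => ?_)
      (fun y => lexCol_cases fun c d h h' => ?_)
    · obtain ⟨rfl, d', rfl, hE⟩ := stepE_old.1 h
      obtain ⟨-, d'', hd, he⟩ := mem_stepLive.1 h'
      rw [WithTop.coe_inj] at he
      subst he
      rw [stepFan_old, T₁.eq_fan _ _ hE hd]
    · obtain ⟨-, d'', hd, he⟩ := mem_stepLive.1 h'
      subst he
      rcases stepE_new.1 h with ⟨rfl, hE⟩ | ⟨hE, -⟩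
      · rw [hE, stepFan_new]
      · exact absurd hE (WithTop.coe_ne_top)
  · refine lexCol_cases fun c d hcd => ?_
    obtain ⟨hc, d, hd, rfl⟩ := mem_stepLive.1 hcd
    obtain ⟨y, hy, hyd⟩ := hσs c hc d hd
    have : (Finset.univ.filter fun z : StepRow T₀ ρ₁ =>
        stepFan T₁ T₀ σ z = toLex (c, (d : WithTop κ₁))) =
        insert (StepRow.new T₀ ρ₁ y) ((Finset.univ.filter fun x => T₁.fan x = d).image
          fun x => StepRow.old T₀ ⟨c, hc⟩ x) := by
      ext z
      induction z using StepRow.cases with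
      | h₁ c' x =>
        simp only [Finset.mem_filter, Finset.mem_univ, true_and, Finset.mem_insert,
          Finset.mem_image, stepFan_old, EmbeddingLike.apply_eq_iff_eq, Prod.mk.injEq,
          WithTop.coe_inj, reduceCtorEq, false_or, Sum.inl.injEq]
        constructor
        · rintro ⟨rfl, h⟩
          exact ⟨x, h, rfl, rfl⟩
        · rintro ⟨x', h, rfl, rfl⟩
          exact ⟨rfl, h⟩
      | h₂ y' =>
        simp only [Finset.mem_filter, Finset.mem_univ, true_and, Finset.mem_insert,
          Finset.mem_image, stepFan_new, EmbeddingLike.apply_eq_iff_eq, Prod.mk.injEq,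
          WithTop.coe_inj, reduceCtorEq, Sum.inr.injEq, and_false, exists_false, or_false]
        constructor
        · rintro ⟨h1, h2⟩
          rcases lt_trichotomy y' y with h | h | h
          · have := hσ _ _ (h1.trans hy.symm) h
            rw [h2, hyd] at this
            exact absurd this (lt_irrefl _)
          · exact h
          · have := hσ _ _ (hy.trans h1.symm) h
            rw [h2, hyd] at this
            exact absurd this (lt_irrefl _)
        · rintro rfl
          exact ⟨hy, hyd⟩
    rw [this, Finset.card_insert_of_notMem, Finset.card_image_of_injective, T₁.fiber d hd]
    · intro x x' h
      simpa using h
    · simp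
  · refine StepRow.cases (fun c x => ?_) (fun y => ?_)
    · obtain ⟨s, hs, h⟩ := T₁.ones x
      refine ⟨s.image fun d : κ₁ => toLex ((c : κ₀), (d : WithTop κ₁)), ?_, ?_⟩
      · rwa [Finset.card_image_of_injective]
        intro d d' h
        simpa using h
      · intro c' hc'
        obtain ⟨d, hd, rfl⟩ := Finset.mem_image.1 hc'
        exact stepE_old.2 ⟨rfl, d, rfl, h d hd⟩
    · obtain ⟨s, hs, h⟩ := T₀.ones y
      refine ⟨insert (toLex (T₀.fan y, ((σ y : κ₁) : WithTop κ₁)))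
        (s.image fun c : κ₀ => toLex (c, (⊤ : WithTop κ₁))), ?_, ?_⟩
      · rw [Finset.card_insert_of_notMem, Finset.card_image_of_injective]
        · omega
        · intro d d' h
          simpa using h
        · simp
      · intro c' hc'
        rw [Finset.mem_insert] at hc'
        rcases hc' with rfl | hc'
        · exact stepE_new.2 (Or.inl ⟨rfl, rfl⟩)
        · obtain ⟨d, hd, rfl⟩ := Finset.mem_image.1 hc'
          exact stepE_new.2 (Or.inr ⟨rfl, h d hd⟩)
  · have h1 : Fintype.card (StepRow T₀ ρ₁) =
        T₀.live.card * Fintype.card ρ₁ + Fintype.card ρ₀ := by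
      rw [show Fintype.card (StepRow T₀ ρ₁) = Fintype.card ((T₀.live × ρ₁) ⊕ ρ₀) from
        Fintype.card_congr (ofLex.trans (Equiv.sumCongr ofLex (Equiv.refl _)))]
      simp
    have h2 := card_rows T₀
    have h3 := T₁.dead_le
    have h4 := T₀.dead_le
    rw [h1]
    calc F * (stepDead T₁ T₀).card ≤
          F * (T₀.live.card * T₁.dead.card + (T₀.live.card + T₀.dead.card)) :=
          Nat.mul_le_mul_left _ card_stepDead
      _ = T₀.live.card * (F * T₁.dead.card) + T₀.live.card * F + F * T₀.dead.card := by ring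
      _ ≤ T₀.live.card * ((k + 1) * Fintype.card ρ₁) + T₀.live.card * T₁.live.card +
          k * Fintype.card ρ₀ := by gcongr
      _ = (k + 1) * (T₀.live.card * Fintype.card ρ₁ + Fintype.card ρ₀) := by
          rw [← h2]; ring

/-- The recursion is of Ackermann type: stage `(k + 1, m + 1)` combines `(k + 1, m)` with `(k, m')`,
where `m'` is the number of live columns of the former. Hence all `m` are needed at level `k`. -/
lemma exists_layered (F k : ℕ) : ∀ m, ∃ (ρ κ : Type) (_ : Fintype ρ) (_ : LinearOrder ρ)
    (_ : LinearOrder κ), Nonempty (Layered ρ κ k m F) := by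
  induction k with
  | zero => exact fun m => ⟨Fin m, Unit, inferInstance, inferInstance, inferInstance, ⟨base m F⟩⟩
  | succ k ihk =>
    intro m
    induction m with
    | zero => exact ⟨Fin 0, Fin (F + 1), inferInstance, inferInstance, inferInstance,
        ⟨noRows (k + 1) F⟩⟩
    | succ m ihm =>
      obtain ⟨ρ₁, κ₁, _, _, _, ⟨T₁⟩⟩ := ihm
      obtain ⟨ρ₀, κ₀, _, _, _, ⟨T₀⟩⟩ := ihk T₁.live.card
      exact ⟨StepRow T₀ ρ₁, κ₀ ×ₗ WithTop κ₁, inferInstance, inferInstance, inferInstance,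
        exists_step (T₁.le_live (Nat.succ_pos k))⟩

end Layered

/-- Dense matrices in which no larger row alternates twice with a smaller one. -/
lemma exists_dense_alternation_free (C N : ℕ) : ∃ (R Q : ℕ) (S : Finset (ℕ × ℕ)),
    N ≤ R ∧ (∀ p ∈ S, p.1 < R ∧ p.2 < Q) ∧ C * (R + Q) < S.card ∧
    ∀ a b c₁ c₂ c₃ c₄, b < a → (a, c₁) ∈ S → (b, c₂) ∈ S → (a, c₃) ∈ S → (b, c₄) ∈ S →
      c₁ < c₂ → c₂ < c₃ → c₃ < c₄ → False := by
  classical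
  -- For `m = 1` there are as many live columns as rows, and `F ≥ k` makes the dead columns no more
  -- numerous. So rows and columns total at most `3 * R`, against at least `(3 * C + 2) * R`
  -- entries.
  set k := 3 * C + 1 with hk
  set F := N + k + 1 with hF
  obtain ⟨ρ, κ, _, _, _, ⟨T⟩⟩ := Layered.exists_layered F k 1
  set R := Fintype.card ρ with hR
  have hlive : R = T.live.card := by rw [hR, T.card_rows, mul_one]
  have hFR : F ≤ R := hlive ▸ T.le_live (by omega)
  have hdead : T.dead.card ≤ R := by
    have h1 := T.dead_le
    have h2 : F * T.dead.card ≤ F * R := h1.trans (Nat.mul_le_mul_right _ (by omega))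
    exact Nat.le_of_mul_le_mul_left h2 (by omega)
  set K := T.live ∪ T.dead with hK
  have hKc : K.card ≤ 2 * R := by
    have := Finset.card_union_le T.live T.dead
    rw [← hK] at this
    omega
  let rk : κ → ℕ := fun c => (K.filter (· < c)).card
  have hrk : ∀ c ∈ K, ∀ c', c < c' → rk c < rk c' := fun c hc c' h => by
    refine Finset.card_lt_card ((Finset.ssubset_iff_of_subset fun d hd => ?_).2 ⟨c, ?_, ?_⟩)
    · simp only [Finset.mem_filter] at hd ⊢
      exact ⟨hd.1, hd.2.trans h⟩
    · simp [hc, h]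
    · simp
  have hrk' : ∀ c ∈ K, rk c < K.card := fun c hc => by
    refine Finset.card_lt_card ((Finset.ssubset_iff_of_subset (Finset.filter_subset _ _)).2
      ⟨c, hc, by simp⟩)
  have hlt : ∀ c ∈ K, ∀ c' ∈ K, rk c < rk c' → c < c' := fun c hc c' hc' h => by
    by_contra hn
    rcases (not_lt.1 hn).lt_or_eq with h' | h'
    · exact absurd (hrk _ hc' _ h') h.not_gt
    · rw [h'] at h; exact lt_irrefl _ h
  have hinj : ∀ c ∈ K, ∀ c' ∈ K, rk c = rk c' → c = c' := fun c hc c' hc' h => by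
    rcases lt_trichotomy c c' with h' | h' | h'
    · exact absurd h (hrk _ hc _ h').ne
    · exact h'
    · exact absurd h (hrk _ hc' _ h').ne'
  let e : ρ ≃o Fin R := (Fintype.orderIsoFinOfCardEq ρ rfl).symm
  have hKE : ∀ y c, T.E y c → c ∈ K := fun y c h => by
    rw [hK, Finset.mem_union]; exact T.mem_of_E y c h
  set P := (Finset.univ ×ˢ K).filter fun p : ρ × κ => T.E p.1 p.2 with hP
  have hmem : ∀ a c, (a, c) ∈ P.image (fun p => ((e p.1 : ℕ), rk p.2)) →
      ∃ y d, T.E y d ∧ (e y : ℕ) = a ∧ rk d = c := by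
    intro a c h
    obtain ⟨⟨y, d⟩, hp, heq⟩ := Finset.mem_image.1 h
    simp only [Prod.mk.injEq] at heq
    exact ⟨y, d, (Finset.mem_filter.1 hp).2, heq.1, heq.2⟩
  refine ⟨R, K.card, P.image fun p => ((e p.1 : ℕ), rk p.2), by omega, ?_, ?_, ?_⟩
  · rintro ⟨a, c⟩ h
    obtain ⟨y, d, hE, rfl, rfl⟩ := hmem a c h
    exact ⟨(e y).2, hrk' _ (hKE _ _ hE)⟩
  · rw [Finset.card_image_of_injOn]
    · have h1 : ∀ y, k + 1 ≤ (P.filter fun p => p.1 = y).card := fun y => by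
        obtain ⟨s, hs, h⟩ := T.ones y
        refine hs.trans (Finset.card_le_card_of_injOn (fun c => (y, c)) (fun c hc => ?_)
          fun c _ c' _ h => by simpa using h)
        simp [hP, hKE _ _ (h c hc), h c hc]
      have h2 : R * (k + 1) ≤ P.card := by
        rw [Finset.card_eq_sum_card_fiberwise (f := Prod.fst) (t := Finset.univ) (by simp)]
        calc R * (k + 1) = ∑ _y : ρ, (k + 1) := by simp [hR]
          _ ≤ _ := Finset.sum_le_sum fun y _ => h1 y
      refine lt_of_lt_of_le ?_ h2
      have h3 : C * (R + K.card) ≤ C * (3 * R) := Nat.mul_le_mul_left _ (by omega)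
      have h4 : R * (k + 1) = C * (3 * R) + 2 * R := by rw [hk]; ring
      omega
    · rintro ⟨y, c⟩ hp ⟨y', c'⟩ hp' heq
      simp only [hP, Finset.coe_filter, Finset.mem_product, Set.mem_ofPred_eq] at hp hp'
      simp only [Prod.mk.injEq] at heq
      have h1 : y = y' := e.injective (Fin.ext heq.1)
      have h2 := hinj _ hp.1.2 _ hp'.1.2 heq.2
      rw [h1, h2]
  · intro a b c₁ c₂ c₃ c₄ hba m1 m2 m3 m4 l1 l2 l3
    obtain ⟨y, d₁, h1, rfl, rfl⟩ := hmem _ _ m1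
    obtain ⟨z, d₂, h2, rfl, rfl⟩ := hmem _ _ m2
    obtain ⟨y', d₃, h3, hy, rfl⟩ := hmem _ _ m3
    obtain ⟨z', d₄, h4, hz, rfl⟩ := hmem _ _ m4
    obtain rfl : y' = y := e.injective (Fin.ext hy)
    obtain rfl : z' = z := e.injective (Fin.ext hz)
    exact T.alt _ _ _ _ _ _ (e.lt_iff_lt.1 (Fin.lt_def.2 hba)) h1 h2 h3 h4
      (hlt _ (hKE _ _ h1) _ (hKE _ _ h2) l1) (hlt _ (hKE _ _ h2) _ (hKE _ _ h3) l2)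
      (hlt _ (hKE _ _ h3) _ (hKE _ _ h4) l3)

variable {V : Type*} [Fintype V] [LinearOrder V] {G : SimpleGraph V}

lemma MinNonlinear.no_alternation (hG : MinNonlinear G) (he : 4 < G.edgeSet.ncard)
    {a b y₁ y₂ y₃ y₄ : V} (hab : a ≠ b) (ha : a < y₁) (hb : b < y₂) (l₁ : y₁ < y₂) (l₂ : y₂ < y₃)
    (l₃ : y₃ < y₄) (h₁ : G.Adj a y₁) (h₂ : G.Adj b y₂) (h₃ : G.Adj a y₃) (h₄ : G.Adj b y₄) :
    False := by
  obtain ⟨C, N, h⟩ := hG.host (T := {s(a, y₁), s(b, y₂), s(a, y₃), s(b, y₄)})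
    (lt_of_le_of_lt Finset.card_le_four he)
  obtain ⟨R, Q, S, hR, hS, hC, halt⟩ := exists_dense_alternation_free C N
  -- Either keep or reverse the order of the rows of the dense matrix.
  have key : ∀ ρ : ℕ → ℕ, (∀ i < R, ρ i < R) → (∀ i < R, ∀ j < R, ρ i = ρ j → i = j) →
      (∀ i < R, ∀ j < R, (b < a → ρ j < ρ i → j < i) ∧ (a < b → ρ i < ρ j → j < i)) → False := by
    intro ρ hρ hρi hρo
    obtain ⟨f, hf, hfS⟩ := h (R + Q) (by omega) (S.image fun p => (ρ p.1, R + p.2))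
      (fun p hp => by
        obtain ⟨q, hq, rfl⟩ := Finset.mem_image.1 hp
        have h1 := hS q hq
        have h2 := hρ q.1 h1.1
        exact ⟨by simp only; omega, by simp only; omega⟩)
      (by
        rwa [Finset.card_image_of_injOn]
        rintro ⟨i, j⟩ hp ⟨i', j'⟩ hp' heq
        simp only [Prod.mk.injEq, Nat.add_left_cancel_iff] at heq
        rw [hρi i (hS _ hp).1 i' (hS _ hp').1 heq.1, heq.2])
    have hm : ∀ u v, u < v → G.Adj u v →
        s(u, v) ∈ ({s(a, y₁), s(b, y₂), s(a, y₃), s(b, y₄)} : Finset (Sym2 V)) →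
        ∃ i j, (i, j) ∈ S ∧ ρ i = f u ∧ R + j = f v := fun u v huv hadj hmem => by
      obtain ⟨⟨i, j⟩, hq, heq⟩ := Finset.mem_image.1 (hfS u v huv hadj hmem)
      simp only [Prod.mk.injEq] at heq
      exact ⟨i, j, hq, heq.1, heq.2⟩
    obtain ⟨i₁, j₁, m₁, e₁, q₁⟩ := hm a y₁ ha h₁ (by simp)
    obtain ⟨i₂, j₂, m₂, e₂, q₂⟩ := hm b y₂ hb h₂ (by simp)
    obtain ⟨i₃, j₃, m₃, e₃, q₃⟩ := hm a y₃ (ha.trans (l₁.trans l₂)) h₃ (by simp)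
    obtain ⟨i₄, j₄, m₄, e₄, q₄⟩ := hm b y₄ (hb.trans (l₂.trans l₃)) h₄ (by simp)
    obtain rfl := hρi _ (hS _ m₁).1 _ (hS _ m₃).1 (e₁.trans e₃.symm)
    obtain rfl := hρi _ (hS _ m₂).1 _ (hS _ m₄).1 (e₂.trans e₄.symm)
    have g₁ := hf l₁
    have g₂ := hf l₂
    have g₃ := hf l₃
    have hlt : i₂ < i₁ := by
      have := hρo i₁ (hS _ m₁).1 i₂ (hS _ m₂).1
      rcases lt_or_gt_of_ne hab with h | h
      · exact this.2 h (by rw [e₁, e₂]; exact hf h)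
      · exact this.1 h (by rw [e₁, e₂]; exact hf h)
    exact halt _ _ _ _ _ _ hlt m₁ m₂ m₃ m₄ (by omega) (by omega) (by omega)
  rcases lt_or_gt_of_ne hab with h | h
  · exact key (fun i => R - 1 - i) (by intros; omega) (by intros; omega)
      fun i hi j hj => ⟨fun h' => absurd h h'.not_gt, fun _ _ => by omega⟩
  · exact key (fun i => i) (by intros; omega) (by intros; omega)
      fun i hi j hj => ⟨fun _ h => h, fun h' => absurd h h'.not_gt⟩

end Alternation

/-! ### Counting the entries of a good matrix -/

section Counting

/-- The forbidden configurations in a `0`-`1` matrix with ordered rows and columns. -/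
structure GoodMatrix {α β : Type*} [LinearOrder α] [LinearOrder β] (M : α → β → Prop) : Prop where
  pp : ∀ {r s s' : α} {y y' x : β}, r ≤ s → s < s' → y < y' → y' ≤ x →
    M r y → M r y' → M s x → M s' x → False
  mp : ∀ {r s s' t : α} {y y' x z : β}, s ≤ r → s' < s → y < y' → y' ≤ x → t ≤ s' → z ≤ y →
    M r y → M r y' → M s x → M s' x → M t z → False
  mm : ∀ {r s s' t : α} {y y' x z : β}, s ≤ r → s' < s → y' < y → x ≤ y' → t ≤ s' → y ≤ z →
    M r y → M r y' → M s x → M s' x → M t z → False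
  pm : ∀ {r s s' t : α} {y y' x z : β}, r ≤ s → s < s' → y' < y → x ≤ y' → s' ≤ t → y ≤ z →
    M r y → M r y' → M s x → M s' x → M t z → False
  abab : ∀ {a b : α} {y₁ y₂ y₃ y₄ : β}, a ≠ b → y₁ < y₂ → y₂ < y₃ → y₃ < y₄ →
    M a y₁ → M b y₂ → M a y₃ → M b y₄ → False
  ins : ∀ {r : α} {y₁ y y₂ : β}, y₁ < y → y < y₂ → M r y₁ → M r y → M r y₂ →
    (∀ b, M b y → b = r) → (∀ w b, M b w → y₁ < w → w < y₂ → w = y) → False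

/-- Both orders are reversed as well, so the first entry of a dual row is the lowest entry of a
column. -/
def dualMatrix {α β : Type*} (M : α → β → Prop) : βᵒᵈ → αᵒᵈ → Prop :=
  fun c r => M (OrderDual.ofDual r) (OrderDual.ofDual c)

/-- A good matrix whose rows and columns are two-coloured, so that a row and a column that meet in
an entry get different colours. -/
structure Conf (α β : Type*) [LinearOrder α] [LinearOrder β] where
  M : α → β → Prop
  P : α → Prop
  Q : β → Prop
  hPQ : ∀ r c, M r c → (P r ↔ ¬ Q c)
  good : GoodMatrix M
  good_dual : GoodMatrix (dualMatrix M)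

namespace Conf

lemma exists_greatest {β : Type*} [LinearOrder β] [Finite β] {p : β → Prop} (h : ∃ d, p d) :
    ∃ d, p d ∧ ∀ v, p v → v ≤ d := by
  obtain ⟨d, hd, h⟩ := Set.exists_max_image {d | p d} id (Set.toFinite _) h
  exact ⟨d, hd, h⟩

open Classical in
/-- The number of pairs with a given property. -/
noncomputable def count {α β : Type*} [Fintype α] [Fintype β] (p : α → β → Prop) : ℕ :=
  (Finset.univ.filter fun q : α × β => p q.1 q.2).card

section Count
variable {α β γ : Type*} [Fintype α] [Fintype β]

lemma count_le_card {p : α → β → Prop} {t : Finset γ} (R : α → β → γ → Prop)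
    (h₁ : ∀ r c, p r c → ∃ g ∈ t, R r c g)
    (h₂ : ∀ r c r' c' g, p r c → p r' c' → R r c g → R r' c' g → r = r' ∧ c = c') :
    count p ≤ t.card := by
  classical
  refine Finset.card_le_card_of_forall_subsingleton (fun q g => R q.1 q.2 g) (fun q hq => ?_)
    fun g _ => ?_
  · simpa using h₁ q.1 q.2 (by simpa using hq)
  · rintro ⟨r, c⟩ ⟨h, hR⟩ ⟨r', c'⟩ ⟨h', hR'⟩
    obtain ⟨rfl, rfl⟩ := h₂ r c r' c' g (by simpa using h) (by simpa using h') hR hR'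
    rfl

lemma count_le_count {α' β' : Type*} [Fintype α'] [Fintype β'] {p : α → β → Prop}
    {q : α' → β' → Prop} (R : α → β → α' → β' → Prop)
    (h₁ : ∀ r c, p r c → ∃ a b, q a b ∧ R r c a b)
    (h₂ : ∀ r c r' c' a b, p r c → p r' c' → R r c a b → R r' c' a b → r = r' ∧ c = c') :
    count p ≤ count q := by
  classical
  refine count_le_card (fun r c g => R r c g.1 g.2) (fun r c h => ?_)
    fun r c r' c' g h h' => h₂ r c r' c' g.1 g.2 h h'
  obtain ⟨a, b, hq, hR⟩ := h₁ r c h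
  exact ⟨(a, b), by simpa using hq, hR⟩

lemma count_mono {p q : α → β → Prop} (h : ∀ r c, p r c → q r c) : count p ≤ count q := by
  classical
  exact Finset.card_le_card fun x hx => by
    simp only [Finset.mem_filter, Finset.mem_univ, true_and] at hx ⊢
    exact h _ _ hx

lemma count_le_add {p q₁ q₂ : α → β → Prop} (h : ∀ r c, p r c → q₁ r c ∨ q₂ r c) :
    count p ≤ count q₁ + count q₂ := by
  classical
  refine (Finset.card_le_card fun x hx => ?_).trans (Finset.card_union_le _ _)
  simp only [Finset.mem_filter, Finset.mem_union, Finset.mem_univ, true_and] at hx ⊢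
  exact h _ _ hx

lemma count_add_le {p q₁ q₂ : α → β → Prop} (h₁ : ∀ r c, q₁ r c → p r c)
    (h₂ : ∀ r c, q₂ r c → p r c) (h : ∀ r c, q₁ r c → q₂ r c → False) :
    count q₁ + count q₂ ≤ count p := by
  classical
  rw [count, count, ← Finset.card_union_of_disjoint]
  · refine Finset.card_le_card fun x hx => ?_
    simp only [Finset.mem_filter, Finset.mem_union, Finset.mem_univ, true_and] at hx ⊢
    exact hx.elim (h₁ _ _) (h₂ _ _)
  · rw [Finset.disjoint_left]
    intro x hx hx'
    simp only [Finset.mem_filter, Finset.mem_univ, true_and] at hx hx'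
    exact h _ _ hx hx'

lemma count_pos {p : α → β → Prop} : 0 < count p ↔ ∃ r c, p r c := by
  classical
  simp [count, Finset.card_pos, Finset.filter_nonempty_iff]

lemma count_dual (p : α → β → Prop) :
    count (fun (c : βᵒᵈ) (r : αᵒᵈ) => p (OrderDual.ofDual r) (OrderDual.ofDual c)) = count p :=
  le_antisymm
    (count_le_count (fun c r a b => OrderDual.ofDual c = b ∧ OrderDual.ofDual r = a)
      (fun _ _ h => ⟨_, _, h, rfl, rfl⟩) fun _ _ _ _ _ _ _ _ h h' =>
        ⟨h.1.trans h'.1.symm, h.2.trans h'.2.symm⟩)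
    (count_le_count (fun r c b a => OrderDual.ofDual b = c ∧ OrderDual.ofDual a = r)
      (fun r c h => ⟨OrderDual.toDual c, OrderDual.toDual r, h, rfl, rfl⟩)
      fun _ _ _ _ _ _ _ _ h h' => ⟨h.2.symm.trans h'.2, h.1.symm.trans h'.1⟩)

end Count

variable {α β : Type*} [LinearOrder α] [LinearOrder β] (K : Conf α β)

def dual : Conf βᵒᵈ αᵒᵈ where
  M := dualMatrix K.M
  P c := K.Q (OrderDual.ofDual c)
  Q r := K.P (OrderDual.ofDual r)
  hPQ c r h := by
    have := K.hPQ _ _ h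
    tauto
  good := K.good_dual
  good_dual := K.good

/-- `c` is the first entry of the row `r`. -/
def First (r : α) (c : β) : Prop := K.P r ∧ K.M r c ∧ ∀ d, K.M r d → c ≤ d

/-- `c` and `d` are consecutive entries of the row `r`. -/
def Next (r : α) (c d : β) : Prop :=
  K.P r ∧ K.M r c ∧ K.M r d ∧ c < d ∧ ∀ v, K.M r v → v ≤ c ∨ d ≤ v

/-- Consecutive entries of a row without a nonempty column between them. -/
def Tight (r : α) (c d : β) : Prop := K.Next r c d ∧ ∀ v b, c < v → v < d → ¬ K.M b v

/-- Consecutive entries of a row with a nonempty column between them, and only columns of the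
other colour. -/
def Gap (r : α) (c d : β) : Prop :=
  K.Next r c d ∧ (∃ v b, c < v ∧ v < d ∧ K.M b v) ∧ ∀ v b, c < v → v < d → K.M b v → K.Q v

/-- Consecutive entries of a row with a nonempty column of the same colour between them. -/
def WideGap (r : α) (c d : β) : Prop :=
  K.Next r c d ∧ ∃ v b, c < v ∧ v < d ∧ K.M b v ∧ ¬ K.Q v

/-- These entries absorb the tight steps: the start of a run of such steps, or a companion in a
column where a run of another row continues. -/
def Used (r : α) (c : β) : Prop :=
  K.M r c ∧ (¬ ∃ y, K.Tight r y c) ∧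
    ((∃ d, K.Tight r c d) ∨ ∃ s, s ≠ r ∧ ∃ d y, K.Tight s c d ∧ K.Tight s y c)

/-- A gap between a second or later entry and the next one, in which a column has two entries
above the row. -/
structure Strong (r : α) (z y c d w : β) (s s' : α) : Prop where
  next : K.Next r z y
  gap : K.Gap r y c
  tight : K.Tight r c d
  lt₁ : y < w
  lt₂ : w < c
  lt₃ : s' < s
  lt₄ : s < r
  mem : K.M s w
  mem' : K.M s' w

def WeakGap (r : α) (c : β) : Prop :=
  ∃ y d, K.First r y ∧ K.Gap r y c ∧ K.Tight r c d

def MidGap (r : α) (c : β) : Prop :=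
  ∃ z y d, K.Next r z y ∧ K.Gap r y c ∧ K.Tight r c d ∧
    ∀ w s s', y < w → w < c → s' < s → s < r → K.M s w → K.M s' w → False

def StrongGap (r : α) (c : β) : Prop := ∃ z y d w s s', K.Strong r z y c d w s s'

/-- `FreeTight`, `FreeLoose` and `FreeShort` are disjoint kinds of unused first entries: the first
pays for weak gaps, the third for mid gaps of the dual, and the second supplies the last unit of the
bound. -/
def FreeTight (r : α) (c : β) : Prop :=
  (K.First r c ∧ ¬ K.Used r c) ∧ ∃ y d, K.Next r c y ∧ K.Tight r y d

def FreeLoose (r : α) (c : β) : Prop :=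
  (K.First r c ∧ ¬ K.Used r c) ∧ ∃ y d, K.Next r c y ∧ K.Next r y d ∧ ¬ K.Tight r y d

def FreeShort (r : α) (c : β) : Prop :=
  (K.First r c ∧ ¬ K.Used r c) ∧ ¬ ∃ y d, K.Next r c y ∧ K.Next r y d

variable {K}

lemma P_of {r b : α} {c : β} (hr : K.P r) (h : K.M r c) (h' : K.M b c) : K.P b :=
  (K.hPQ _ _ h').2 ((K.hPQ _ _ h).1 hr)

lemma not_Q {r : α} {c : β} (hr : K.P r) (h : K.M r c) : ¬ K.Q c := (K.hPQ _ _ h).1 hr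

lemma Next.right_unique {r : α} {c d d' : β} (h : K.Next r c d) (h' : K.Next r c d') : d = d' := by
  obtain ⟨-, -, h1, h2, h3⟩ := h
  obtain ⟨-, -, h1', h2', h3'⟩ := h'
  exact le_antisymm ((h3 _ h1').resolve_left h2'.not_ge) ((h3' _ h1).resolve_left h2.not_ge)

lemma Next.left_unique {r : α} {c c' d : β} (h : K.Next r c d) (h' : K.Next r c' d) : c = c' := by
  obtain ⟨-, h1, -, h2, h3⟩ := h
  obtain ⟨-, h1', -, h2', h3'⟩ := h'
  exact le_antisymm ((h3' _ h1).resolve_right h2.not_ge) ((h3 _ h1').resolve_right h2'.not_ge)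

lemma Gap.not_tight {r : α} {c d : β} (h : K.Gap r c d) : ¬ K.Tight r c d := fun h' => by
  obtain ⟨-, ⟨v, b, h1, h2, h3⟩, -⟩ := h
  exact h'.2 v b h1 h2 h3

lemma WideGap.not_tight {r : α} {c d : β} (h : K.WideGap r c d) : ¬ K.Tight r c d := fun h' => by
  obtain ⟨-, v, b, h1, h2, h3, -⟩ := h
  exact h'.2 v b h1 h2 h3

/-- Both parts are instances of `pp`. Consequently a column holds at most one entry that is not
first in its row, and that entry is the lowest of the column. -/
lemma late {r b : α} {y c : β} (hy : K.M r y) (hyc : y < c) (hc : K.M r c) (hb : K.M b c)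
    (hbr : b ≠ r) : b < r ∧ ∀ v, K.M b v → c ≤ v := by
  have h : ¬ r < b := fun h => K.good.pp le_rfl h hyc le_rfl hy hc hc hb
  refine ⟨lt_of_le_of_ne (not_lt.1 h) hbr, fun v hv => not_lt.1 fun hvc => ?_⟩
  exact K.good.pp le_rfl (lt_of_le_of_ne (not_lt.1 h) hbr) hvc le_rfl hv hb hb hc

lemma late_unique {r b : α} {y z c : β} (hy : K.M r y) (hyc : y < c) (hc : K.M r c)
    (hz : K.M b z) (hzc : z < c) (hb : K.M b c) : r = b := by
  by_contra hne
  exact ((late hy hyc hc hb (Ne.symm hne)).2 z hz).not_gt hzc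

lemma Next.row_unique {r b : α} {y z c : β} (h : K.Next r y c) (h' : K.Next b z c) :
    r = b ∧ y = z := by
  obtain rfl := late_unique h.2.1 h.2.2.2.1 h.2.2.1 h'.2.1 h'.2.2.2.1 h'.2.2.1
  exact ⟨rfl, h.left_unique h'⟩

/-- By tightness a further entry of `r` would lie at `d` or beyond, and `r` is above `s` by `late`;
this is the configuration `mm`. -/
lemma mate_last {s r : α} {y c d e : β} (h : K.Tight s c d) (h' : K.Next s y c) (hrs : r ≠ s)
    (hr : K.M r c) (he : K.M r e) (hce : c < e) : False := by
  have hlt := (late h'.2.1 h'.2.2.2.1 h'.2.2.1 hr hrs).1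
  have hde : d ≤ e := not_lt.1 fun hed => h.2 e r hce hed he
  exact K.good.mm le_rfl hlt h.1.2.2.2.1 le_rfl le_rfl hde h.1.2.2.1 h.1.2.1 h.1.2.1 hr he

lemma Used.tight {r : α} {c d : β} (h : K.Used r c) (h' : K.Next r c d) : K.Tight r c d := by
  obtain ⟨hm, -, ⟨e, he⟩ | ⟨s, hs, e, y, h1, h2⟩⟩ := h
  · rwa [h'.right_unique he.1]
  · exact (mate_last h1 h2.1 hs.symm hm h'.2.2.1 h'.2.2.2.1).elim

section Finite
variable [Fintype α] [Fintype β]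

omit [Fintype α] in
lemma exists_next {r : α} {c d : β} (hr : K.P r) (hc : K.M r c) (hd : K.M r d) (h : d < c) :
    ∃ y, K.Next r y c := by
  obtain ⟨y, ⟨h1, h2⟩, h3⟩ := exists_greatest (p := fun v => K.M r v ∧ v < c) ⟨d, hd, h⟩
  refine ⟨y, hr, h1, hc, h2, fun v hv => ?_⟩
  rcases lt_or_ge v c with h | h
  · exact Or.inl (h3 v ⟨hv, h⟩)
  · exact Or.inr h

omit [Fintype α] in
lemma entry_cases {r : α} {c : β} (hr : K.P r) (hc : K.M r c) :
    K.First r c ∨ (∃ y, K.Tight r y c) ∨ (∃ y, K.Gap r y c) ∨ ∃ y, K.WideGap r y c := by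
  by_cases hf : K.First r c
  · exact Or.inl hf
  · obtain ⟨d, hd, hlt⟩ : ∃ d, K.M r d ∧ d < c := by
      by_contra! hn
      exact hf ⟨hr, hc, hn⟩
    obtain ⟨y, hy⟩ := exists_next hr hc hd hlt
    by_cases h1 : ∃ v b, y < v ∧ v < c ∧ K.M b v
    · by_cases h2 : ∀ v b, y < v → v < c → K.M b v → K.Q v
      · exact Or.inr (Or.inr (Or.inl ⟨y, hy, h1, h2⟩))
      · push Not at h2
        exact Or.inr (Or.inr (Or.inr ⟨y, hy, h2⟩))
    · push Not at h1
      exact Or.inr (Or.inl ⟨y, hy, h1⟩)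

lemma count_entries_le : count (fun r c => K.P r ∧ K.M r c) ≤
    count K.First + (count (fun r c => ∃ y, K.Tight r y c) +
      (count (fun r c => ∃ y, K.Gap r y c) + count fun r c => ∃ y, K.WideGap r y c)) :=
  (count_le_add fun _ _ h => entry_cases h.1 h.2).trans <| Nat.add_le_add_left
    ((count_le_add fun _ _ h => h).trans <| Nat.add_le_add_left (count_le_add fun _ _ h => h) _) _

open Classical in
noncomputable def rows (K : Conf α β) : Finset α :=
  Finset.univ.filter fun r => K.P r ∧ ∃ c, K.M r c

lemma mem_rows {r : α} : r ∈ K.rows ↔ K.P r ∧ ∃ c, K.M r c := by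
  simp [rows]

open Classical in
noncomputable def cols (K : Conf α β) : Finset β :=
  Finset.univ.filter fun c => K.Q c ∧ ∃ r, K.M r c

lemma mem_cols {c : β} : c ∈ K.cols ↔ K.Q c ∧ ∃ r, K.M r c := by
  simp [cols]

lemma count_first_le : count K.First ≤ K.rows.card :=
  count_le_card (fun r _ g => r = g) (fun r c h => ⟨r, mem_rows.2 ⟨h.1, c, h.2.1⟩, rfl⟩)
    fun r c r' c' g h h' hr hr' => by
      subst hr
      subst hr'
      exact ⟨rfl, le_antisymm (h.2.2 _ h'.2.1) (h'.2.2 _ h.2.1)⟩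

lemma count_entries_eq_zero (h : K.rows.card = 0) : count (fun r c => K.P r ∧ K.M r c) = 0 := by
  by_contra hn
  obtain ⟨r, c, hr, hc⟩ := count_pos.1 (Nat.pos_of_ne_zero hn)
  exact (Finset.card_pos.2 ⟨r, mem_rows.2 ⟨hr, c, hc⟩⟩).ne' h

/-- The last column of the same colour before `c` lies in the gap and belongs to a row `b` that ends
there, by `abab`. The end of `b` determines `c`, and `late_unique` then determines `r`. The row
reaching the overall last such column is not used, which gives the `- 1`. -/
lemma count_wideGap_le : count (fun r c => ∃ y, K.WideGap r y c) ≤ K.rows.card - 1 := by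
  classical
  by_cases hex : ∃ W b, K.P b ∧ K.M b W
  swap
  · have : ¬ 0 < count (fun r c => ∃ y, K.WideGap r y c) := fun h => by
      obtain ⟨r, c, y, h, -⟩ := count_pos.1 h
      exact hex ⟨c, r, h.1, h.2.2.1⟩
    omega
  obtain ⟨W, ⟨b₀, hb₀, hbW⟩, hW⟩ := exists_greatest hex
  rw [← Finset.card_erase_of_mem (mem_rows.2 ⟨hb₀, W, hbW⟩)]
  refine count_le_card (fun r c b => ∃ w, K.M b w ∧ (∀ d, K.M b d → d ≤ w) ∧ w < c ∧
    ∀ v a, K.P a → K.M a v → v < c → v ≤ w) ?_ ?_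
  · rintro r c ⟨y, hn, v, a, h1, h2, h3, h4⟩
    have hPa : ∀ {a v}, K.M a v → ¬ K.Q v → K.P a := fun h h' => (K.hPQ _ _ h).2 h'
    obtain ⟨w, ⟨b, hb, hbw, hwc⟩, hw⟩ := exists_greatest
      (p := fun v => ∃ a, K.P a ∧ K.M a v ∧ v < c) ⟨v, a, hPa h3 h4, h3, h2⟩
    have hyw : y < w := h1.trans_le (hw v ⟨a, hPa h3 h4, h3, h2⟩)
    have hbr : r ≠ b := by
      rintro rfl
      rcases hn.2.2.2.2 w hbw with h | h
      · exact h.not_gt hyw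
      · exact h.not_gt hwc
    have hlast : ∀ d, K.M b d → d ≤ w := fun d hd => by
      by_contra hwd
      rw [not_le] at hwd
      rcases lt_trichotomy d c with h | rfl | h
      · exact hwd.not_ge (hw d ⟨b, hb, hd, h⟩)
      · exact hbr (late_unique hn.2.1 hn.2.2.2.1 hn.2.2.1 hbw hwc hd)
      · exact K.good.abab hbr hyw hwc h hn.2.1 hbw hn.2.2.1 hd
    refine ⟨b, Finset.mem_erase.2 ⟨?_, mem_rows.2 ⟨hb, w, hbw⟩⟩, w, hbw, hlast, hwc,
      fun v a ha hv hvc => hw v ⟨a, ha, hv, hvc⟩⟩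
    rintro rfl
    exact (hlast W hbW).not_gt (hwc.trans_le (hW c ⟨r, hn.1, hn.2.2.1⟩))
  · rintro r c r' c' b ⟨y, hn, -⟩ ⟨y', hn', -⟩ ⟨w, h1, h2, h3, h4⟩ ⟨w', h1', h2', h3', h4'⟩
    obtain rfl : w = w' := le_antisymm (h2' _ h1) (h2 _ h1')
    rcases lt_trichotomy c c' with h | rfl | h
    · exact absurd (h4' c r hn.1 hn.2.2.1 h) h3.not_ge
    · exact ⟨(hn.row_unique hn').1, rfl⟩
    · exact absurd (h4 c' r' hn'.1 hn'.2.2.1 h) h3'.not_ge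

/-- The last nonempty column before `c` lies in the gap, so it has colour `Q`, and it determines
`c`. -/
lemma count_gap_le : count (fun r c => ∃ y, K.Gap r y c) ≤ K.cols.card := by
  refine count_le_card (fun r c p => p < c ∧ ∀ v a, K.M a v → v < c → v ≤ p) ?_ ?_
  · rintro r c ⟨y, hn, ⟨v, b, h1, h2, h3⟩, h4⟩
    obtain ⟨p, ⟨⟨a, ha⟩, hpc⟩, hp⟩ := exists_greatest (p := fun v => (∃ a, K.M a v) ∧ v < c)
      ⟨v, ⟨b, h3⟩, h2⟩
    have hyp := h1.trans_le (hp v ⟨⟨b, h3⟩, h2⟩)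
    exact ⟨p, mem_cols.2 ⟨h4 p a hyp hpc ha, a, ha⟩, hpc, fun v a ha hvc => hp v ⟨⟨a, ha⟩, hvc⟩⟩
  · rintro r c r' c' p ⟨y, hn, -⟩ ⟨y', hn', -⟩ ⟨h1, h2⟩ ⟨h1', h2'⟩
    rcases lt_trichotomy c c' with h | rfl | h
    · exact absurd (h2' c r hn.2.2.1 h) h1.not_ge
    · exact ⟨(hn.row_unique hn').1, rfl⟩
    · exact absurd (h2 c' r' hn'.2.2.1 h) h1'.not_ge

/-- A tight step from `y` is charged to `(r, y)` if no tight step of `r` ends there. Otherwise `y`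
lies between two tight steps, `ins` yields another row in that column, and its entry is charged;
`mate_last` prevents a double charge. -/
lemma count_tight_le : count (fun r c => ∃ y, K.Tight r y c) ≤
    count (fun r c => K.First r c ∧ K.Used r c) +
      (count (fun r c => (∃ y, K.Gap r y c) ∧ K.Used r c) +
        count fun r c => (∃ y, K.WideGap r y c) ∧ K.Used r c) := by
  have h1 : count (fun r c => ∃ y, K.Tight r y c) ≤ count fun r c => K.P r ∧ K.Used r c := by
    refine count_le_count (fun r c b y => K.Tight r y c ∧ K.M b y ∧
      (b = r ∨ (b ≠ r ∧ ∃ z, K.Tight r z y))) ?_ ?_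
    · rintro r c ⟨y, hy⟩
      by_cases hz : ∃ z, K.Tight r z y
      · obtain ⟨z, hz⟩ := hz
        obtain ⟨b, hb, hbr⟩ : ∃ b, K.M b y ∧ b ≠ r := by
          by_contra! hn
          refine K.good.ins hz.1.2.2.2.1 hy.1.2.2.2.1 hz.1.2.1 hy.1.2.1 hy.1.2.2.1 hn
            fun w b hb h1 h2 => ?_
          rcases lt_trichotomy w y with h | h | h
          · exact absurd hb (hz.2 w b h1 h)
          · exact h
          · exact absurd hb (hy.2 w b h h2)
        refine ⟨b, y, ⟨P_of hy.1.1 hy.1.2.1 hb, hb, ?_, Or.inr ⟨r, hbr.symm, c, z, hy, hz⟩⟩, hy, hb,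
          Or.inr ⟨hbr, z, hz⟩⟩
        rintro ⟨z', hz'⟩
        exact hbr (hz'.1.row_unique hz.1).1
      · exact ⟨r, y, ⟨hy.1.1, hy.1.2.1, hz, Or.inl ⟨c, hy⟩⟩, hy, hy.1.2.1, Or.inl rfl⟩
    · rintro r c r' c' b y - - ⟨h1, h2, h3⟩ ⟨h1', -, h3'⟩
      obtain rfl : r = r' := by
        rcases h3 with rfl | ⟨hb, z, hz⟩
        · rcases h3' with h | ⟨hb, z, hz⟩
          · exact h
          · exact (mate_last h1' hz.1 hb h2 h1.1.2.2.1 h1.1.2.2.2.1).elim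
        · rcases h3' with rfl | ⟨hb', z', hz'⟩
          · exact (mate_last h1 hz.1 hb h2 h1'.1.2.2.1 h1'.1.2.2.2.1).elim
          · exact (hz.1.row_unique hz'.1).1
      exact ⟨rfl, h1.1.right_unique h1'.1⟩
  refine h1.trans ((count_le_add fun r c h => ?_).trans <|
    Nat.add_le_add_left (count_le_add fun _ _ h => h) _)
  rcases entry_cases h.1 h.2.1 with h' | h' | h' | h'
  · exact Or.inl ⟨h', h.2⟩
  · exact absurd h' h.2.2.1
  · exact Or.inr (Or.inl ⟨h', h.2⟩)
  · exact Or.inr (Or.inr ⟨h', h.2⟩)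

lemma count_usedGap_le : count (fun r c => (∃ y, K.Gap r y c) ∧ K.Used r c) ≤
    count K.WeakGap + (count K.MidGap + count K.StrongGap) := by
  refine (count_le_add fun r c h => ?_).trans <|
    Nat.add_le_add_left (count_le_add fun _ _ h => h) _
  obtain ⟨⟨y, hy⟩, hm, -, h⟩ := h
  obtain ⟨d, hd⟩ : ∃ d, K.Tight r c d := by
    rcases h with h | ⟨s, hs, d, z, -, hz⟩
    · exact h
    · exact absurd (hz.1.row_unique hy.1).1 hs
  by_cases hf : K.First r y
  · exact Or.inl ⟨y, d, hf, hy, hd⟩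
  · obtain ⟨v, hv, hlt⟩ : ∃ d, K.M r d ∧ d < y := by
      by_contra! hn
      exact hf ⟨hy.1.1, hy.1.2.1, hn⟩
    obtain ⟨z, hz⟩ := exists_next hy.1.1 hy.1.2.1 hv hlt
    by_cases hX : ∃ w s s', y < w ∧ w < c ∧ s' < s ∧ s < r ∧ K.M s w ∧ K.M s' w
    · obtain ⟨w, s, s', h1, h2, h3, h4, h5, h6⟩ := hX
      exact Or.inr (Or.inr ⟨z, y, d, w, s, s', hz, hy, hd, h1, h2, h3, h4, h5, h6⟩)
    · push Not at hX
      exact Or.inr (Or.inl ⟨z, y, d, hz, hy, hd, hX⟩)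

lemma count_weakGap_le : count K.WeakGap ≤ count K.FreeTight := by
  refine count_le_count (fun r c a b => a = r ∧ K.Next r b c) ?_ ?_
  · rintro r c ⟨y, d, h1, h2, h3⟩
    exact ⟨r, y, ⟨⟨h1, fun h => h2.not_tight (h.tight h2.1)⟩, c, d, h2.1, h3⟩, rfl, h2.1⟩
  · rintro r c r' c' a b - - ⟨rfl, h1⟩ ⟨rfl, h2⟩
    exact ⟨rfl, h1.right_unique h2⟩

lemma count_free_le : count (fun r c => K.First r c ∧ K.Used r c) +
    (count K.FreeTight + (count K.FreeLoose + count K.FreeShort)) ≤ count K.First := by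
  have h1 : count K.FreeLoose + count K.FreeShort ≤
      count fun r c => (K.First r c ∧ ¬ K.Used r c) ∧
        ¬ ∃ y d, K.Next r c y ∧ K.Tight r y d := by
    refine count_add_le ?_ ?_ ?_
    · rintro r c ⟨h, y, d, h1, h2, h3⟩
      refine ⟨h, fun ⟨y', d', h1', h2'⟩ => h3 ?_⟩
      obtain rfl := h1.right_unique h1'
      rwa [h2.right_unique h2'.1]
    · rintro r c ⟨h, hn⟩
      exact ⟨h, fun ⟨y', d', h1', h2'⟩ => hn ⟨y', d', h1', h2'.1⟩⟩
    · rintro r c ⟨-, y, d, h1, h2, -⟩ ⟨-, hn⟩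
      exact hn ⟨y, d, h1, h2⟩
  have h2 : count K.FreeTight + count (fun r c => (K.First r c ∧ ¬ K.Used r c) ∧
        ¬ ∃ y d, K.Next r c y ∧ K.Tight r y d) ≤ count fun r c => K.First r c ∧ ¬ K.Used r c :=
    count_add_le (fun _ _ h => h.1) (fun _ _ h => h.1) fun _ _ h h' => h'.2 h.2
  have h3 : count (fun r c => K.First r c ∧ K.Used r c) +
      count (fun r c => K.First r c ∧ ¬ K.Used r c) ≤ count K.First :=
    count_add_le (fun _ _ h => h.1) (fun _ _ h => h.1) fun _ _ h h' => h'.2 h.2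
  omega

/-- The charge goes to the lowest entry `s` of the last nonempty column `x` before `c`, a column of
the gap. By `pp` only the lowest entry of a gap column can be below `r`, and a mid gap allows at
most one above. So `x` has at most two entries; being used in the dual would put two entries of a
gap column above `r`, or the nonempty row `r` inside a tight step. -/
lemma count_midGap_le : count K.MidGap ≤ count K.dual.FreeShort := by
  refine count_le_count (fun r c x _ => (OrderDual.ofDual x) < c ∧
    ∀ v a, K.M a v → v < c → v ≤ OrderDual.ofDual x) ?_ ?_
  · rintro r c ⟨z, y, d, hz, hy, hd, hX⟩
    obtain ⟨v, b, h1, h2, h3⟩ := hy.2.1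
    obtain ⟨x, ⟨⟨a, ha⟩, hxc⟩, hx⟩ := exists_greatest (p := fun v => (∃ a, K.M a v) ∧ v < c)
      ⟨v, ⟨b, h3⟩, h2⟩
    have hyx : y < x := h1.trans_le (hx v ⟨⟨b, h3⟩, h2⟩)
    have hQ : K.Q x := hy.2.2 x a hyx hxc ha
    obtain ⟨s, hs, hmax⟩ := exists_greatest (p := fun a => K.M a x) ⟨a, ha⟩
    -- The columns of the gap have at most one row below `r`.
    have hpp : ∀ {w t t'}, y < w → K.M t w → K.M t' w → t < t' → t < r := fun hw ht ht' hlt =>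
      not_le.1 fun h => K.good.pp h hlt hz.2.2.2.1 hw.le hz.2.1 hz.2.2.1 ht ht'
    have hne : ∀ {t w}, K.M t w → K.Q w → t ≠ r := by
      rintro t w ht hw rfl
      exact not_Q hy.1.1 ht hw
    refine ⟨OrderDual.toDual x, OrderDual.toDual s, ⟨⟨⟨hQ, hs, fun t ht => hmax t ht⟩, ?_⟩, ?_⟩,
      hxc, fun v a ha hv => hx v ⟨⟨a, ha⟩, hv⟩⟩
    · rintro ⟨-, -, ⟨t, ⟨-, -, ht, hts, -⟩, ht'⟩ |
        ⟨x', hxx, t, t', ⟨⟨-, -, ht, hts, -⟩, -⟩, ⟨⟨-, ht', hs', hst, -⟩, -⟩⟩⟩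
      · change K.M t x at ht
        change @LT.lt α _ t s at hts
        have h1 : @LT.lt α _ t r := hpp hyx ht hs hts
        have h2 : s < r := by
          refine lt_of_le_of_ne (not_lt.1 fun h => ?_) (hne hs hQ)
          exact ht' r c h h1 hy.1.2.2.1
        exact hX x s t hyx hxc hts h2 hs ht
      · change K.M t x' at ht
        change K.M t' x' at ht'
        change K.M s x' at hs'
        change @LT.lt α _ t s at hts
        change @LT.lt α _ s t' at hst
        have hPs : ¬ K.P s := fun h => not_Q h hs hQ
        have hQ' : K.Q x' := by
          by_contra h
          exact hPs ((K.hPQ _ _ hs').2 h)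
        have hxy : y < x' := by
          rcases lt_trichotomy y x' with h | h | h
          · exact h
          · rw [← h] at hQ'
            exact absurd hQ' (not_Q hy.1.1 hy.1.2.1)
          · exact (K.good.abab (hne hs hQ) h hyx hxc hs' hy.1.2.1 hs hy.1.2.2.1).elim
        have hx'x : @LT.lt β _ x' x :=
          (late (K := K.dual) (r := x') (b := OrderDual.toDual x) (y := t') (c := OrderDual.toDual s)
            ht' hst hs' hs (Ne.symm hxx)).1
        exact hX x' s t hxy (hx'x.trans hxc) hts (hpp hxy hs' ht' hst) hs' ht
    · rintro ⟨t, t', ⟨-, -, ht, hts, -⟩, ⟨-, -, ht', htt, -⟩⟩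
      change K.M t x at ht
      change K.M t' x at ht'
      change @LT.lt α _ t s at hts
      change @LT.lt α _ t' t at htt
      exact hX x t t' hyx hxc htt (hpp hyx ht hs hts) ht ht'
  · rintro r c r' c' x _ ⟨_, y, _, _, hy, -⟩ ⟨_, y', _, _, hy', -⟩ ⟨h1, h2⟩ ⟨h1', h2'⟩
    rcases lt_trichotomy c c' with h | rfl | h
    · exact absurd (h2' c r hy.1.2.2.1 h) h1.not_ge
    · exact ⟨(hy.1.row_unique hy'.1).1, rfl⟩
    · exact absurd (h2 c' r' hy'.1.2.2.1 h) h1'.not_ge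

omit [Fintype α] [Fintype β] in
-- An entry left of the window completes `mp` with the step from `z` to `y`, and one right of it
-- completes `mm` with the step from `c` to `d`.
lemma Strong.window {r s s' t : α} {z y c d w v : β} (h : K.Strong r z y c d w s s')
    (ht : t ≤ s') (hv : K.M t v) : z < v ∧ v < d := by
  constructor
  · refine not_le.1 fun hvz => ?_
    exact K.good.mp h.lt₄.le h.lt₃ h.next.2.2.2.1 h.lt₁.le ht hvz h.next.2.1 h.next.2.2.1 h.mem
      h.mem' hv
  · refine not_le.1 fun hvz => ?_
    exact K.good.mm h.lt₄.le h.lt₃ h.tight.1.2.2.2.1 h.lt₂.le ht hvz h.tight.1.2.2.1 h.tight.1.2.1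
      h.mem h.mem' hv

omit [Fintype α] [Fintype β] in
-- The column `w` meets row `s'`, so it lies in the window of the second gap. Were it not left of
-- `y₁`, it would enter the tight step or the two gaps would overlap, and one would contain an end
-- of the other, which has the wrong colour. Then `c` lies between `z₁` and `y₁`.
lemma Strong.wideGap {r s s' r₁ s₁ s₁' : α} {z y c d w z₁ y₁ c₁ d₁ w₁ : β}
    (h : K.Strong r z y c d w s s') (h₁ : K.Strong r₁ z₁ y₁ c₁ d₁ w₁ s₁ s₁')
    (hne : (r, c) ≠ (r₁, c₁)) (hs : s' ≤ s₁') : K.WideGap r₁ z₁ y₁ := by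
  have hcc : c ≠ c₁ := by
    rintro rfl
    exact hne (by rw [(h.gap.1.row_unique h₁.gap.1).1])
  obtain ⟨hw1, hw2⟩ := h₁.window hs h.mem'
  have hQ : K.Q w := h.gap.2.2 w s h.lt₁ h.lt₂ h.mem
  have hnQ : ∀ {r c}, K.P r → K.M r c → w ≠ c := by
    rintro r _ hr hc rfl
    exact not_Q hr hc hQ
  have hwc : w < c₁ := by
    refine lt_of_le_of_ne (not_lt.1 fun h' => ?_) (hnQ h₁.gap.1.1 h₁.gap.1.2.2.1)
    exact h₁.tight.2 w s h' hw2 h.mem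
  have hwy : w < y₁ := by
    refine lt_of_le_of_ne (not_lt.1 fun h' => ?_) (hnQ h₁.gap.1.1 h₁.gap.1.2.1)
    rcases lt_or_gt_of_ne hcc with hc | hc
    · exact not_Q h.gap.1.1 h.gap.1.2.2.1 (h₁.gap.2.2 c r (h'.trans h.lt₂) hc h.gap.1.2.2.1)
    · exact not_Q h₁.gap.1.1 h₁.gap.1.2.2.1
        (h.gap.2.2 c₁ r₁ (h.lt₁.trans hwc) hc h₁.gap.1.2.2.1)
  have hcy : c < y₁ := by
    rcases lt_trichotomy c y₁ with hc | rfl | hc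
    · exact hc
    · obtain ⟨rfl, -⟩ := h.gap.1.row_unique h₁.next
      have := h₁.gap.not_tight
      rw [← h.tight.1.right_unique h₁.gap.1] at this
      exact absurd h.tight this
    · exact absurd (h.gap.2.2 y₁ r₁ (h.lt₁.trans hwy) hc h₁.next.2.2.1)
        (not_Q h₁.gap.1.1 h₁.next.2.2.1)
  exact ⟨h₁.next, c, r, hw1.trans h.lt₂, hcy, h.gap.1.2.2.1, not_Q h.gap.1.1 h.gap.1.2.2.1⟩

lemma count_strongGap_le (hpos : 0 < count K.StrongGap) :
    count (fun r c => (∃ y, K.WideGap r y c) ∧ K.Used r c) + count K.StrongGap ≤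
      count (fun r c => ∃ y, K.WideGap r y c) + 1 := by
  classical
  obtain ⟨r₀, c₀, h₀⟩ := count_pos.1 hpos
  have hex : ∀ q : α × β, ∃ t : α, K.StrongGap q.1 q.2 →
      ∃ z y d w s, K.Strong q.1 z y q.2 d w s t := fun q => by
    by_cases h : K.StrongGap q.1 q.2
    · obtain ⟨z, y, d, w, s, s', h⟩ := h
      exact ⟨s', fun _ => ⟨z, y, d, w, s, h⟩⟩
    · exact ⟨q.1, fun h' => absurd h' h⟩
  choose φ hφ using hex
  -- Relative to the strong gap with the highest row `s'`, every other strong gap is preceded by a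
  -- wide gap, whose end is unused because a gap follows it.
  obtain ⟨⟨r₁, c₁⟩, hq, hmin⟩ := Set.exists_min_image {q : α × β | K.StrongGap q.1 q.2} φ
    (Set.toFinite _) ⟨(r₀, c₀), h₀⟩
  obtain ⟨z₁, y₁, d₁, w₁, s₁, h₁⟩ := hφ _ hq
  have hA : count (fun r c => K.StrongGap r c ∧ (r, c) ≠ (r₁, c₁)) ≤
      count fun r c => (∃ y, K.WideGap r y c) ∧ ¬ K.Used r c := by
    refine count_le_count (fun r c a b => a = r ∧ K.Gap r b c) ?_ ?_
    · rintro r c ⟨hS, hne⟩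
      obtain ⟨z, y, d, w, s, h⟩ := hφ (r, c) hS
      exact ⟨r, y, ⟨⟨z, h₁.wideGap h hne.symm (hmin (r, c) hS)⟩,
        fun hU => h.gap.not_tight (hU.tight h.gap.1)⟩, rfl, h.gap⟩
    · rintro r c r' c' a b - - ⟨rfl, h1⟩ ⟨rfl, h2⟩
      exact ⟨rfl, h1.1.right_unique h2.1⟩
  have hB : count K.StrongGap ≤ count (fun r c => K.StrongGap r c ∧ (r, c) ≠ (r₁, c₁)) + 1 := by
    refine (count_le_add (q₂ := fun r c => (r, c) = (r₁, c₁)) fun r c h => ?_).trans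
      (Nat.add_le_add_left ?_ _)
    · by_cases h' : (r, c) = (r₁, c₁)
      · exact Or.inr h'
      · exact Or.inl ⟨h, h'⟩
    · rw [← Finset.card_singleton (r₁, c₁)]
      exact count_le_card (fun r c q => q = (r, c)) (fun r c h => ⟨_, Finset.mem_singleton.2 h, rfl⟩)
        fun r c r' c' g _ _ h h' => by simpa using h.symm.trans h'
  have hC : count (fun r c => (∃ y, K.WideGap r y c) ∧ K.Used r c) +
      count (fun r c => (∃ y, K.WideGap r y c) ∧ ¬ K.Used r c) ≤
      count fun r c => ∃ y, K.WideGap r y c :=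
    count_add_le (fun _ _ h => h.1) (fun _ _ h => h.1) fun _ _ h h' => h'.2 h.2
  omega

omit [Fintype α] [Fintype β] in
-- Otherwise `x` is left of the window, so `b₁` and `b₂` lie below `s'`. Dual tightness puts them on
-- the same side of `r`: above it `mm` is violated through `(s', w)`, below it `pm` through `(t,
-- u')`, after `mm` has shown `y < u'`.
lemma lt_of_strong {r s s' : α} {z y c d w : β} (h : K.Strong r z y c d w s s')
    {x : β} {a₂ a₁ b₁ b₂ t : α} {u u' : β}
    (h' : K.dual.Strong (OrderDual.toDual x) (OrderDual.toDual a₂) (OrderDual.toDual a₁)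
      (OrderDual.toDual b₁) (OrderDual.toDual b₂) (OrderDual.toDual t) (OrderDual.toDual u)
      (OrderDual.toDual u')) : z < x := by
  have hQ : K.Q x := h'.next.1
  have hu : x < u := h'.lt₄
  have huu : u < u' := h'.lt₃
  have hb₁ : K.M b₁ x := h'.gap.1.2.2.1
  have hb₂ : K.M b₂ x := h'.tight.1.2.2.1
  have hbb : b₂ < b₁ := h'.tight.1.2.2.2.1
  have hbt : b₁ < t := h'.lt₂
  have htu : K.M t u := h'.mem
  have htu' : K.M t u' := h'.mem'
  have hnb : ∀ {a v}, K.M a v → b₂ < a → a < b₁ → False := fun {a v} hm h1 h2 =>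
    h'.tight.2 a v h2 h1 hm
  rcases lt_trichotomy z x with hzx | rfl | hxz
  · exact hzx
  · exact absurd hQ (not_Q h.next.1 h.next.2.1)
  exfalso
  have hs : ∀ {t}, K.M t x → s' < t := fun ht =>
    not_le.1 fun hle => (h.window hle ht).1.not_gt hxz
  have hr : ∀ {t}, K.M t x → t ≠ r := by
    rintro t ht rfl
    exact not_Q h.next.1 ht hQ
  rcases lt_or_gt_of_ne (hr hb₁) with hlt | hlt
  · exact K.good.mm hlt.le hbb h.next.2.2.2.1 hxz.le (hs hb₂).le h.lt₁.le h.next.2.2.1 h.next.2.1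
      hb₁ hb₂ h.mem'
  · have hrb : r < b₂ := by
      refine lt_of_le_of_ne (not_lt.1 fun h1 => ?_) (hr hb₂).symm
      exact hnb h.next.2.1 h1 hlt
    have hyu : y < u' := by
      refine not_le.1 fun huy => ?_
      exact K.good.mm hbt.le hbb huu hu.le hrb.le huy htu' htu hb₁ hb₂ h.next.2.2.1
    exact K.good.pm hrb.le hbb h.next.2.2.2.1 hxz.le hbt.le hyu.le h.next.2.2.1 h.next.2.1 hb₂ hb₁
      htu'

omit [Fintype α] [Fintype β] in
lemma Strong.freeLoose_or {r s s' b : α} {z y c d w x : β} (h : K.Strong r z y c d w s s')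
    (hzx : z < x) (hx : K.M b x) : K.FreeLoose r z ∨ ∃ e₁ e₂, e₁ < e₂ ∧ e₂ ≤ x ∧ K.M r e₁ ∧
      K.M r e₂ := by
  by_cases hy : y ≤ x
  · exact Or.inr ⟨z, y, h.next.2.2.2.1, hy, h.next.2.1, h.next.2.2.1⟩
  by_cases hf : K.First r z
  · exact Or.inl ⟨⟨hf, fun hU => (hU.tight h.next).2 x b hzx (not_le.1 hy) hx⟩, y, c, h.next,
      h.gap.1, h.gap.not_tight⟩
  · obtain ⟨v, hv, hlt⟩ : ∃ v, K.M r v ∧ v < z := by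
      by_contra! hn
      exact hf ⟨h.next.1, h.next.2.1, hn⟩
    exact Or.inr ⟨v, z, hlt, hzx.le, hv, h.next.2.1⟩

omit [Fintype α] [Fintype β] in
-- If neither exists, row `r` has two entries at or before column `x`, and column `x` has two
-- entries at or below row `r`; this is `pp`.
lemma exists_freeLoose (h : ∃ r c, K.StrongGap r c) (h' : ∃ x t, K.dual.StrongGap x t) :
    (∃ r c, K.FreeLoose r c) ∨ ∃ x t, K.dual.FreeLoose x t := by
  obtain ⟨r, c, z, y, d, w, s, s', h⟩ := h
  obtain ⟨x, b₁, a₂, a₁, b₂, t, u, u', h'⟩ := h'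
  have h1 : z < OrderDual.ofDual x := lt_of_strong h h'
  have h2 : a₂ < OrderDual.toDual r := lt_of_strong (K := K.dual) h' h
  rcases h.freeLoose_or h1 h'.next.2.1 with hl | ⟨e₁, e₂, he, hex, m₁, m₂⟩
  · exact Or.inl ⟨_, _, hl⟩
  rcases h'.freeLoose_or h2 (b := OrderDual.toDual z) h.next.2.1 with hl | ⟨f₁, f₂, hf, hfr, n₁, n₂⟩
  · exact Or.inr ⟨_, _, hl⟩
  exact (K.good.pp hfr hf he hex m₁ m₂ n₂ n₁).elim

lemma card_rows_dual : K.dual.rows.card = K.cols.card :=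
  Finset.card_nbij OrderDual.ofDual (fun _ hc => mem_cols.2 (mem_rows.1 hc))
    (fun _ _ _ _ h => h) fun c hc => ⟨OrderDual.toDual c, mem_rows.2 (mem_cols.1 hc), rfl⟩

lemma card_cols_dual : K.dual.cols.card = K.rows.card :=
  card_rows_dual (K := K.dual).symm

lemma count_strongGap_le_gap : count K.StrongGap ≤ count fun r c => ∃ y, K.Gap r y c :=
  count_mono fun _ _ ⟨_, y, _, _, _, _, h⟩ => ⟨y, h.gap⟩

theorem count_add_three_le (h : 0 < count K.M) :
    count K.M + 3 ≤ 5 * (K.rows.card + K.cols.card) := by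
  have hM : count K.M ≤ count (fun r c => K.P r ∧ K.M r c) +
      count fun c r => K.dual.P c ∧ K.dual.M c r := by
    have hd : count (fun c r => K.dual.P c ∧ K.dual.M c r) = count fun r c => K.Q c ∧ K.M r c :=
      count_dual fun r c => K.Q c ∧ K.M r c
    rw [hd]
    refine count_le_add fun r c h => ?_
    by_cases hr : K.P r
    · exact Or.inl ⟨hr, h⟩
    · exact Or.inr ⟨by_contra fun hc => hr ((K.hPQ _ _ h).2 hc), h⟩
  have hz := count_entries_eq_zero (K := K)
  have hz' := count_entries_eq_zero (K := K.dual)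
  have e₁ := count_entries_le (K := K)
  have e₂ := count_entries_le (K := K.dual)
  have f₁ := count_first_le (K := K)
  have f₂ := count_first_le (K := K.dual)
  have w₁ := count_wideGap_le (K := K)
  have w₂ := count_wideGap_le (K := K.dual)
  have g₁ := count_gap_le (K := K)
  have g₂ := count_gap_le (K := K.dual)
  have t₁ := count_tight_le (K := K)
  have t₂ := count_tight_le (K := K.dual)
  have u₁ := count_usedGap_le (K := K)
  have u₂ := count_usedGap_le (K := K.dual)
  have v₁ := count_weakGap_le (K := K)
  have v₂ := count_weakGap_le (K := K.dual)
  have m₁ := count_midGap_le (K := K)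
  have m₂ : count K.dual.MidGap ≤ count K.FreeShort := count_midGap_le (K := K.dual)
  have r₁ := count_free_le (K := K)
  have r₂ := count_free_le (K := K.dual)
  have s₁ := count_strongGap_le_gap (K := K)
  have s₂ := count_strongGap_le_gap (K := K.dual)
  have x₁ : count (fun r c => (∃ y, K.WideGap r y c) ∧ K.Used r c) ≤
      count fun r c => ∃ y, K.WideGap r y c := count_mono fun _ _ h => h.1
  have x₂ : count (fun r c => (∃ y, K.dual.WideGap r y c) ∧ K.dual.Used r c) ≤
      count fun r c => ∃ y, K.dual.WideGap r y c := count_mono fun _ _ h => h.1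
  have y₁ := count_strongGap_le (K := K)
  have y₂ := count_strongGap_le (K := K.dual)
  have hl : 0 < count K.StrongGap → 0 < count K.dual.StrongGap →
      0 < count K.FreeLoose ∨ 0 < count K.dual.FreeLoose := fun h h' => by
    rw [count_pos] at h h' ⊢
    rw [count_pos]
    exact exists_freeLoose h h'
  rw [card_rows_dual] at f₂ w₂ hz'
  rw [card_cols_dual] at g₂
  -- For positive row and column counts, the sum is `5 * (p + q) - 4` plus one for each side with
  -- strong gaps, less the loose first entries. The zero cases are separate because the `- 1` for
  -- wide gaps is then truncated.
  omega

end Finite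
end Conf
end Counting

/-! ### The two edge bounds -/

section Main

variable {V : Type*} [Fintype V] [LinearOrder V] {G : SimpleGraph V}

/-- The adjacency matrix, rows being left endpoints and columns right endpoints. -/
def upperMatrix (G : SimpleGraph V) (r c : V) : Prop := r < c ∧ G.Adj r c

lemma count_upperMatrix (G : SimpleGraph V) : Conf.count (upperMatrix G) = G.edgeSet.ncard := by
  rw [ncard_edgeSet_eq, Conf.count]
  congr 1
  ext p
  simp only [mem_edgePairs, Finset.mem_filter_univ]
  rfl

lemma MinNonlinear.row_lt_col (hG : MinNonlinear G) (he : 3 ≤ G.edgeSet.ncard) {a b c d : V}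
    (h : upperMatrix G a b) (h' : upperMatrix G c d) : a < d :=
  hG.interval he h.2 h.1 h'.2 h'.1

/-- Patterns with five edges are excluded by minimality only if `G` has a sixth. For a star, a row
with two entries and a column with two entries would both be the centre, but rows precede columns.
-/
lemma MinNonlinear.goodMatrix_upperMatrix (hG : MinNonlinear G) (he : 3 ≤ G.edgeSet.ncard)
    (h : 5 < G.edgeSet.ncard ∨ ∃ v, ∀ a b, G.Adj a b → a = v ∨ b = v) :
    GoodMatrix (upperMatrix G) := by
  have hrc : ∀ {a b c d : V}, upperMatrix G a b → upperMatrix G c d → a < d :=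
    fun h h' => hG.row_lt_col he h h'
  have hrow : ∀ {v a y y' : V}, (∀ a b, G.Adj a b → a = v ∨ b = v) → upperMatrix G a y →
      upperMatrix G a y' → y ≠ y' → a = v := by
    intro v a y y' hv h h' hne
    rcases hv _ _ h.2 with h1 | h1
    · exact h1
    · exact (hv _ _ h'.2).resolve_right fun h2 => hne (h1.trans h2.symm)
  have hcol : ∀ {v a b y : V}, (∀ a b, G.Adj a b → a = v ∨ b = v) → upperMatrix G a y →
      upperMatrix G b y → a ≠ b → y = v := by
    intro v a b y hv h h' hne
    rcases hv _ _ h.2 with h1 | h1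
    · exact (hv _ _ h'.2).resolve_left fun h2 => hne (h1.trans h2.symm)
    · exact h1
  have hstar : ∀ {v r s s' y y' x : V}, (∀ a b, G.Adj a b → a = v ∨ b = v) → s ≠ s' → y ≠ y' →
      upperMatrix G r y → upperMatrix G r y' → upperMatrix G s x → upperMatrix G s' x → False := by
    intro v r s s' y y' x hv hs hy h1 h2 h3 h4
    have h5 := hrc h1 h3
    rw [hrow hv h1 h2 hy, hcol hv h3 h4 hs] at h5
    exact lt_irrefl _ h5
  refine ⟨?_, ?_, ?_, ?_, ?_, ?_⟩
  · intro r s s' y y' x l1 l2 l3 l4 h1 h2 h3 h4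
    rcases h with h | ⟨v, hv⟩
    · exact hG.no_pp (lt_of_le_of_lt Finset.card_le_four (by omega)) l1 l2 l3 l4 (hrc h4 h1)
        h1.2 h2.2 h3.2 h4.2
    · exact hstar hv l2.ne l3.ne h1 h2 h3 h4
  · intro r s s' t y y' x z l1 l2 l3 l4 l5 l6 h1 h2 h3 h4 h5
    rcases h with h | ⟨v, hv⟩
    · exact hG.no_mp h l1 l2 l3 l4 l5 l6 (hrc h1 h5) h1.2 h2.2 h3.2 h4.2 h5.2
    · exact hstar hv l2.ne' l3.ne h1 h2 h3 h4
  · intro r s s' t y y' x z l1 l2 l3 l4 l5 l6 h1 h2 h3 h4 h5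
    rcases h with h | ⟨v, hv⟩
    · exact hG.no_mm h l1 l2 l3 l4 l5 l6 (hrc h1 h3) h1.2 h2.2 h3.2 h4.2 h5.2
    · exact hstar hv l2.ne' l3.ne' h1 h2 h3 h4
  · intro r s s' t y y' x z l1 l2 l3 l4 l5 l6 h1 h2 h3 h4 h5
    rcases h with h | ⟨v, hv⟩
    · exact hG.no_pm h l1 l2 l3 l4 l5 l6 (hrc h5 h3) h1.2 h2.2 h3.2 h4.2 h5.2
    · exact hstar hv l2.ne l3.ne' h1 h2 h3 h4
  · intro a b y₁ y₂ y₃ y₄ hab l1 l2 l3 h1 h2 h3 h4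
    rcases h with h | ⟨v, hv⟩
    · exact hG.no_alternation (by omega) hab h1.1 h2.1 l1 l2 l3 h1.2 h2.2 h3.2 h4.2
    · exact hab ((hrow hv h1 h3 (l1.trans l2).ne).trans (hrow hv h2 h4 (l2.trans l3).ne).symm)
  · intro r y₁ y y₂ l1 l2 h1 h2 h3 hd hi
    refine hG.no_insertion h1.1 l1 l2 h1.2 h2.2 h3.2 (fun b hb => ?_) fun w b hb l l' => ?_
    · rcases lt_or_gt_of_ne hb.ne with hlt | hlt
      · exact hd b ⟨hlt, hb⟩
      · exact absurd (hrc ⟨hlt, hb.symm⟩ h2) (lt_irrefl _)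
    · rcases lt_or_gt_of_ne hb.ne with hlt | hlt
      · exact hi w b ⟨hlt, hb⟩ l l'
      · exact absurd (hrc ⟨hlt, hb.symm⟩ h1) l.not_gt

lemma MinNonlinear.goodMatrix_dual (hG : MinNonlinear G) (he : 3 ≤ G.edgeSet.ncard)
    (h : 5 < G.edgeSet.ncard ∨ ∃ v, ∀ a b, G.Adj a b → a = v ∨ b = v) :
    GoodMatrix (dualMatrix (upperMatrix G)) := by
  have heq : dualMatrix (upperMatrix G) = upperMatrix (dualGraph G) := by
    funext c r
    exact propext ⟨fun h => ⟨h.1, h.2.symm⟩, fun h => ⟨h.1, h.2.symm⟩⟩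
  rw [heq]
  exact (hG.anti (AntiIso.dual G)).goodMatrix_upperMatrix he h

lemma MinNonlinear.ncard_edgeSet_lt_card (hG : MinNonlinear G) :
    G.edgeSet.ncard + 1 ≤ Fintype.card V := by
  classical
  by_contra! hlt
  have h0 := hG.edgeSet_ncard_pos
  have he : 3 ≤ G.edgeSet.ncard := by
    by_contra! he
    have h1 := G.card_edgeFinset_le_card_choose_two
    rw [← Set.ncard_coe_finset, SimpleGraph.coe_edgeFinset] at h1
    have h2 : (Fintype.card V).choose 2 ≤ Nat.choose 2 2 := Nat.choose_le_choose 2 (by omega)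
    have h3 : (Fintype.card V).choose 2 ≤ Nat.choose 1 2 :=
      Nat.choose_le_choose 2 (by simp at h2; omega)
    simp at h3
    omega
  have hrc : ∀ {a b c d : V}, upperMatrix G a b → upperMatrix G c d → a < d :=
    fun h h' => hG.row_lt_col he h h'
  -- This is `pp` with a repeated edge, so it has three distinct edges. A fourth edge exists because
  -- the negated bound gives at least as many edges as vertices.
  have hz : ∀ {r r' c d : V}, r < r' → c < d → upperMatrix G r c → upperMatrix G r d →
      upperMatrix G r' d → False := by
    intro r r' c d l1 l2 h1 h2 h3
    have h4 : r' < c := hrc h3 h1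
    have hV : 4 ≤ Fintype.card V := by
      have : ({r, r', c, d} : Finset V).card = 4 := by
        rw [Finset.card_insert_of_notMem, Finset.card_insert_of_notMem, Finset.card_pair l2.ne]
        · simp [h4.ne, (h4.trans l2).ne]
        · simp [l1.ne, h1.1.ne, h2.1.ne]
      rw [← this]
      exact Finset.card_le_univ _
    refine hG.no_pp (r := r) (s := r) (s' := r') (y := c) (y' := d) (x := d) ?_ le_rfl l1 l2 le_rfl
      h4 h1.2 h2.2 h2.2 h3.2
    have : ({s(r, c), s(r, d), s(r, d), s(r', d)} : Finset (Sym2 V)).card ≤ 3 := by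
      rw [Finset.insert_idem]
      exact Finset.card_le_three
    omega
  obtain ⟨r₀, c₀, h₀⟩ := Conf.count_pos.1 ((count_upperMatrix G).symm ▸ h0)
  obtain ⟨c₁, ⟨r₁, h₁⟩, hmin⟩ := Set.exists_min_image {c | ∃ r, upperMatrix G r c} id
    (Set.toFinite _) ⟨c₀, r₀, h₀⟩
  have hle : Conf.count (upperMatrix G) ≤ (Finset.univ.erase c₁).card := by
    refine Conf.count_le_card (fun r c g => ((∀ d, upperMatrix G r d → c ≤ d) ∧ g = r) ∨
      (∃ d, upperMatrix G r d ∧ d < c) ∧ g = c) ?_ ?_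
    · intro r c h
      by_cases hf : ∀ d, upperMatrix G r d → c ≤ d
      · exact ⟨r, Finset.mem_erase.2 ⟨(hrc h h₁).ne, Finset.mem_univ _⟩, Or.inl ⟨hf, rfl⟩⟩
      · push Not at hf
        obtain ⟨d, hd, hlt⟩ := hf
        exact ⟨c, Finset.mem_erase.2 ⟨((hmin d ⟨r, hd⟩).trans_lt hlt).ne', Finset.mem_univ _⟩,
          Or.inr ⟨⟨d, hd, hlt⟩, rfl⟩⟩
    · rintro r c r' c' g h h' (⟨hf, rfl⟩ | ⟨⟨d, hd, hlt⟩, rfl⟩) (⟨hf', hg⟩ | ⟨⟨d', hd', hlt'⟩, hg⟩)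
      · subst hg
        exact ⟨rfl, le_antisymm (hf _ h') (hf' _ h)⟩
      · exact absurd hg (hrc h h').ne
      · exact absurd hg (hrc h' h).ne'
      · subst hg
        refine ⟨?_, rfl⟩
        rcases lt_trichotomy r r' with hr | hr | hr
        · exact (hz hr hlt hd h h').elim
        · exact hr
        · exact (hz hr hlt' hd' h' h).elim
  rw [count_upperMatrix, Finset.card_erase_of_mem (Finset.mem_univ _), Finset.card_univ] at hle
  omega

lemma MinNonlinear.ncard_edgeSet_add_three_le (hG : MinNonlinear G) {A B : Set V}
    (hAB : G.IsBipartiteWith A B) : G.edgeSet.ncard + 3 ≤ 5 * A.ncard := by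
  have h0 := hG.edgeSet_ncard_pos
  have hmem : ∀ {a b}, G.Adj a b → (a ∈ A ↔ b ∉ A) := fun {a b} h => by
    have hd := Set.disjoint_left.1 hAB.disjoint
    rcases hAB.mem_of_adj h with ⟨h1, h2⟩ | ⟨h1, h2⟩
    · exact ⟨fun _ h => hd h h2, fun _ => h1⟩
    · exact ⟨fun h => (hd h h1).elim, fun h => (h h2).elim⟩
  have hA : 0 < A.ncard := by
    obtain ⟨r, c, h⟩ := Conf.count_pos.1 ((count_upperMatrix G).symm ▸ h0)
    rw [Set.ncard_pos (Set.toFinite _)]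
    by_cases hr : r ∈ A
    · exact ⟨r, hr⟩
    · exact ⟨c, by_contra fun hc => hr ((hmem h.2).2 hc)⟩
  by_contra! hlt
  by_cases he : 3 ≤ G.edgeSet.ncard
  swap
  · omega
  -- If `A` has at least two vertices, violating the bound already forces more than five edges; if
  -- it has one, `G` is a star.
  have hcase : 5 < G.edgeSet.ncard ∨ ∃ v, ∀ a b, G.Adj a b → a = v ∨ b = v := by
    by_cases h1 : A.ncard = 1
    · obtain ⟨v, rfl⟩ := Set.ncard_eq_one.1 h1
      refine Or.inr ⟨v, fun a b hab => or_iff_not_imp_right.2 fun hb => (hmem hab).2 hb⟩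
    · exact Or.inl (by omega)
  let K : Conf V V :=
    { M := upperMatrix G
      P := fun r => r ∈ A
      Q := fun c => c ∈ A
      hPQ := fun r c h => hmem h.2
      good := hG.goodMatrix_upperMatrix he hcase
      good_dual := hG.goodMatrix_dual he hcase }
  have hK : Conf.count (upperMatrix G) + 3 ≤ 5 * (K.rows.card + K.cols.card) :=
    Conf.count_add_three_le (K := K) (by
      change 0 < Conf.count (upperMatrix G)
      rwa [count_upperMatrix])
  have hcard : K.rows.card + K.cols.card ≤ A.ncard := by
    classical
    rw [← Finset.card_union_of_disjoint, ← Set.ncard_coe_finset]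
    · refine Set.ncard_le_ncard (fun v hv => ?_) (Set.toFinite _)
      rw [Finset.mem_coe, Finset.mem_union] at hv
      exact hv.elim (fun h => (Conf.mem_rows.1 h).1) fun h => (Conf.mem_cols.1 h).1
    · rw [Finset.disjoint_left]
      intro v hv hv'
      obtain ⟨-, c, hc⟩ := Conf.mem_rows.1 hv
      obtain ⟨-, r, hr⟩ := Conf.mem_cols.1 hv'
      exact lt_irrefl _ (hG.row_lt_col he hc hr)
  rw [count_upperMatrix] at hK
  omega

end Main

theorem mainTheorem6 {V : Type*} [Fintype V] [LinearOrder V] (G : SimpleGraph V)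
    (hG : MinNonlinear G) :
    (G.IsBipartite → ¬ Nonempty (G ≃g completeBipartiteGraph (Fin 2) (Fin 2)) →
      G.edgeSet.ncard + 1 ≤ Fintype.card V) ∧
    (∀ A B : Set V, G.IsBipartiteWith A B → A ∪ B = Set.univ →
      G.edgeSet.ncard + 3 ≤ 5 * A.ncard) :=
  ⟨fun _ _ => hG.ncard_edgeSet_lt_card, fun _ _ hAB _ => hG.ncard_edgeSet_add_three_le hAB⟩
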